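/- Let $\mathbb{T}=\{z\in\mathbb{C}:|z|=1\}$ and $\mathbb{D}=\{z\in\mathbb{C}:|z|<1\}$. A finite real (signed) Borel measure $\mu$ on $\mathbb{T}^2$ is called an RP-measure if its Poisson integral $$P[d\mu](z)=\int_{\mathbb{T}^2}\prod_{j=1}^{2}\frac{1-|z_j|^2}{|\zeta_j-z_j|^2}\,d\mu(\zeta),\qquad z\in\mathbb{D}^2,$$ is the real part of an analytic function on $\mathbb{D}^2$. Let $\Phi:\mathbb{R}^2\to\mathbb{T}^2$ be the map $\Phi(x_1,x_2)=(e^{ix_1},e^{ix_2})$. Let $\psi:\mathbb{R}\to\mathbb{R}$ be a strictly increasing function (not assumed to be continuous), with graph $F=\{(x,\psi(x)):x\in\mathbb{R}\}$. Then every compact subset $K\subset\Phi(F)$ is a null set for all RP-measures on $\mathbb{T}^2$, that is, $|\mu|(K)=0$ for every RP-measure $\mu$, where $|\mu|$ denotes the total variation of $\mu$. In particular, if $\mu$ is an RP-measure whose (closed) support, i.e. the support of $|\mu|$, is contained in $\Phi(F)$, then $\mu=0$. -/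

import Mathlib

open MeasureTheory

/-- The unit circle carries its Borel `σ`-algebra; products of it carry the product `σ`-algebra,
which is again the Borel `σ`-algebra. -/
noncomputable instance instMeasurableSpaceCircle : MeasurableSpace Circle := borel Circle

instance instBorelSpaceCircle : BorelSpace Circle := ⟨rfl⟩

/-- The torus `𝕋ⁿ`, the `n`-fold product of the unit circle `{z ∈ ℂ : |z| = 1}`. -/
abbrev Torus (n : ℕ) : Type := Fin n → Circle

/-- The open unit polydisc `𝔻ⁿ ⊆ ℂⁿ`. -/
def openPolydisc (n : ℕ) : Set (Fin n → ℂ) := {z | ∀ j, ‖z j‖ < 1}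

/-- The Poisson kernel `∏ⱼ (1 - |zⱼ|²) / |ζⱼ - zⱼ|²` of the polydisc. -/
noncomputable def poissonKernelPolydisc {n : ℕ} (z : Fin n → ℂ) (ζ : Torus n) : ℝ :=
  ∏ j, (1 - ‖z j‖ ^ 2) / ‖(ζ j : ℂ) - z j‖ ^ 2

/-- The Poisson integral `P[dμ](z) = ∫ ∏ⱼ (1 - |zⱼ|²) / |ζⱼ - zⱼ|² dμ(ζ)` of a (finite) real Borel
measure `μ` on `𝕋ⁿ`. -/
noncomputable def poissonIntegral {n : ℕ} (μ : SignedMeasure (Torus n)) (z : Fin n → ℂ) : ℝ :=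
  ∫ᵛ ζ, poissonKernelPolydisc z ζ ∂<•μ

/-- `μ ∈ RP(𝕋ⁿ)`: the Poisson integral of the real measure `μ` is the real part of an analytic
function on `𝔻ⁿ`. -/
def IsRPMeasure {n : ℕ} (μ : SignedMeasure (Torus n)) : Prop :=
  ∃ f : (Fin n → ℂ) → ℂ, AnalyticOnNhd ℂ f (openPolydisc n) ∧
    ∀ z ∈ openPolydisc n, poissonIntegral μ z = (f z).re

/-- A set is a null set for `RP(𝕋ⁿ)` if `|μ|(S) = 0` for every `μ ∈ RP(𝕋ⁿ)`, where `|μ|` is the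
total variation measure of `μ`. -/
def IsNullForRP {n : ℕ} (S : Set (Torus n)) : Prop :=
  ∀ μ : SignedMeasure (Torus n), IsRPMeasure μ → μ.totalVariation S = 0

/-- The covering map `Φ(x₁, …, xₙ) = (e^{i x₁}, …, e^{i xₙ})` from `ℝⁿ` to `𝕋ⁿ`. -/
noncomputable def torusCover {n : ℕ} (x : Fin n → ℝ) : Torus n := fun j => Circle.exp (x j)

/-- The graph `{(x, ψ(x)) : x ∈ ℝ} ⊆ ℝ²` of a function `ψ : ℝ → ℝ`. -/
def planeGraph (ψ : ℝ → ℝ) : Set (Fin 2 → ℝ) := {p | p 1 = ψ (p 0)}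

open Metric Set Filter Topology ComplexConjugate

/-! Let `P` and `N` be the Jordan parts of an RP-measure. On the torus of radius `r` the Poisson
integral is the real part of a holomorphic function, so it has no Fourier coefficients of mixed
sign. Hence `P` and `N` give the same integral to every product `g(ζ₁) · conj h(ζ₂)` with `g`, `h`
holomorphic near the closed disc and zero at the origin (`IsRPMeasure.integral_mul_conj_eq`). Only
this relation and the mutual singularity of `P` and `N` are used afterwards, in angular coordinates
(`IsRPPair`).

Graphs over Lebesgue null sets. A compact null set of angles is a peak set
(`exists_tendsto_indicator`), so the first variable can be localised to it. The second variable can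
then be rotated by any measurable function of the first, and a peak function at `1` isolates the
graph of that function. Thus `P` and `N` agree on measurable graphs over null sets, and singularity
makes both vanish there (`IsRPPair.measure_graph_eq_zero`).

Steep graphs. Let `ψ' ≥ 1/n` on a compact set `S`. Superpose products of Szegő kernels centred at
the points `(s, ψ s)`, divided by their width `d` (`curveKernel`). As `d → 0` this stays bounded,
because the `L²` norms squared of both factors are `O(d)`, and it tends to `0` off the graph. On the
graph monotonicity prevents cancellation: up to an error tending to `0` the real part is
nonnegative, and it is bounded below where `S` has density one. If `N` vanishes on the graph, the
integral of the kernel over the graph against `P` tends to `0`, and Fatou's lemma leaves only the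
graph over the null set of non-density points (`IsSteepOn.measure_graph_eq_zero`).

Conclusion. Where `ψ` is not differentiable the base is null. Where `ψ' = 0` the image is null, and
the first case applies to the inverse function after exchanging the variables. Where `ψ' > 0` the
graph is a countable union of steep pieces. Unit squares with integer corners cover the plane. -/

/-- The point `e^{it}` of the unit circle, as a complex number. -/
noncomputable def unitExp (t : ℝ) : ℂ := Complex.exp (t * Complex.I)

lemma norm_unitExp (t : ℝ) : ‖unitExp t‖ = 1 := Complex.norm_exp_ofReal_mul_I t

@[fun_prop]
lemma continuous_unitExp : Continuous unitExp := by unfold unitExp; fun_prop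

lemma unitExp_sub (s t : ℝ) : unitExp (s - t) = unitExp s * unitExp (-t) := by
  simp only [unitExp, ← Complex.exp_add]; push_cast; ring_nf

/-- A function vanishing at the origin and holomorphic in a neighbourhood of the closed unit
disc. -/
def IsDiscTest (g : ℂ → ℂ) : Prop := (∃ R > 1, DifferentiableOn ℂ g (ball 0 R)) ∧ g 0 = 0

/-- Lebesgue measure on a period of the circle. -/
noncomputable abbrev periodMeasure : Measure ℝ := volume.restrict (Ioc 0 (2 * Real.pi))

/-! ### Mean value and Poisson formulas on the circle. -/

lemma DifferentiableOn.diffContOnCl_unitBall {g : ℂ → ℂ} {R : ℝ} (hR : 1 < R)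
    (hg : DifferentiableOn ℂ g (ball 0 R)) : DiffContOnCl ℂ g (ball 0 1) := by
  apply DifferentiableOn.diffContOnCl
  rw [closure_ball 0 one_ne_zero]
  exact hg.mono (closedBall_subset_ball hR)

lemma circleAverage_zero_one_eq (g : ℂ → ℂ) :
    Real.circleAverage g 0 1 = (2 * Real.pi : ℂ)⁻¹ * ∫ a, g (unitExp a) ∂periodMeasure := by
  rw [Real.circleAverage_def, intervalIntegral.integral_of_le (by positivity)]
  simp only [circleMap, unitExp, Complex.real_smul]
  push_cast
  simp

lemma integral_unitExp_eq {g : ℂ → ℂ} {R : ℝ} (hR : 1 < R)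
    (hg : DifferentiableOn ℂ g (ball 0 R)) :
    ∫ a, g (unitExp a) ∂periodMeasure = 2 * Real.pi * g 0 := by
  have h := DiffContOnCl.circleAverage (f := g) (c := 0) (R := 1)
    (by simpa using hg.diffContOnCl_unitBall hR)
  rw [circleAverage_zero_one_eq] at h
  rw [← h]
  have : (Real.pi : ℂ) ≠ 0 := by exact_mod_cast Real.pi_ne_zero
  field_simp

lemma integral_poisson_mul {g : ℂ → ℂ} {R : ℝ} (hR : 1 < R)
    (hg : DifferentiableOn ℂ g (ball 0 R)) {w : ℂ} (hw : ‖w‖ < 1) :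
    ∫ a, (((1 - ‖w‖ ^ 2) / ‖unitExp a - w‖ ^ 2 : ℝ) : ℂ) * g (unitExp a) ∂periodMeasure
      = 2 * Real.pi * g w := by
  have h := DiffContOnCl.circleAverage_poissonKernel_smul' (f := g) (c := 0) (R := 1) (w := w)
    (hg.diffContOnCl_unitBall hR) (by simpa using hw)
  rw [circleAverage_zero_one_eq] at h
  rw [← h]
  have : (Real.pi : ℂ) ≠ 0 := by exact_mod_cast Real.pi_ne_zero
  simp only [sub_zero, norm_unitExp, Complex.real_smul, one_pow]
  field_simp

lemma norm_sub_mul_comm {a b : ℂ} (ha : ‖a‖ = 1) (hb : ‖b‖ = 1) (r : ℝ) :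
    ‖a - r * b‖ = ‖b - r * a‖ := by
  rw [← sq_eq_sq₀ (norm_nonneg _) (norm_nonneg _), ← Complex.normSq_eq_norm_sq,
    ← Complex.normSq_eq_norm_sq]
  have ha' : a.re * a.re + a.im * a.im = 1 := by
    rw [← Complex.normSq_apply, Complex.normSq_eq_norm_sq, ha, one_pow]
  have hb' : b.re * b.re + b.im * b.im = 1 := by
    rw [← Complex.normSq_apply, Complex.normSq_eq_norm_sq, hb, one_pow]
  simp only [Complex.normSq_apply, Complex.sub_re, Complex.sub_im, Complex.mul_re, Complex.mul_im,
    Complex.ofReal_re, Complex.ofReal_im]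
  linear_combination (1 - r ^ 2) * ha' - (1 - r ^ 2) * hb'

/-! ### Orthogonality relations for RP-measures. -/

/-- The point `(r e^{ia}, r e^{ib})` of the bidisc. -/
noncomputable def bidiscPoint (r : ℝ) (q : ℝ × ℝ) : Fin 2 → ℂ :=
  ![r * unitExp q.1, r * unitExp q.2]

lemma continuous_bidiscPoint (r : ℝ) : Continuous (bidiscPoint r) := by
  unfold bidiscPoint
  refine continuous_pi fun j => ?_
  fin_cases j
  · simp only [Fin.zero_eta, Matrix.cons_val_zero]; fun_prop
  · simp only [Fin.mk_one, Matrix.cons_val_one, Matrix.cons_val_zero]; fun_prop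

lemma norm_real_mul_unitExp {r : ℝ} (hr : 0 ≤ r) (a : ℝ) : ‖(r : ℂ) * unitExp a‖ = r := by
  simp [norm_unitExp, abs_of_nonneg hr]

lemma bidiscPoint_mem {r : ℝ} (h0 : 0 ≤ r) (h1 : r < 1) (q : ℝ × ℝ) :
    bidiscPoint r q ∈ openPolydisc 2 := by
  intro j
  fin_cases j <;> simp [bidiscPoint, norm_unitExp, abs_of_nonneg h0, h1]

lemma poissonKernelPolydisc_bidiscPoint {r : ℝ} (h0 : 0 ≤ r) (q : ℝ × ℝ) (ζ : Torus 2) :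
    poissonKernelPolydisc (bidiscPoint r q) ζ =
      ((1 - ‖(r : ℂ) * ζ 0‖ ^ 2) / ‖unitExp q.1 - r * ζ 0‖ ^ 2) *
      ((1 - ‖(r : ℂ) * ζ 1‖ ^ 2) / ‖unitExp q.2 - r * ζ 1‖ ^ 2) := by
  simp only [poissonKernelPolydisc, Fin.prod_univ_two, bidiscPoint, Matrix.cons_val_zero,
    Matrix.cons_val_one, norm_real_mul_unitExp h0]
  rw [norm_sub_mul_comm (norm_unitExp q.1) (Circle.norm_coe _),
    norm_sub_mul_comm (norm_unitExp q.2) (Circle.norm_coe _)]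
  simp [abs_of_nonneg h0, Circle.norm_coe]

lemma one_sub_le_norm_sub {a b : ℂ} (ha : ‖a‖ = 1) (hb : ‖b‖ = 1) {r : ℝ} (h0 : 0 ≤ r) :
    1 - r ≤ ‖a - r * b‖ := by
  have := norm_sub_norm_le a (r * b)
  simpa [ha, hb, abs_of_nonneg h0] using this

lemma continuous_poissonKernel_bidiscPoint {r : ℝ} (h0 : 0 ≤ r) (h1 : r < 1) :
    Continuous fun x : Torus 2 × ℝ × ℝ => poissonKernelPolydisc (bidiscPoint r x.2) x.1 := by
  simp only [poissonKernelPolydisc_bidiscPoint h0]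
  have key : ∀ (a : ℝ) (b : Circle), ‖unitExp a - r * b‖ ^ 2 ≠ 0 := fun a b => by
    have := one_sub_le_norm_sub (norm_unitExp a) (Circle.norm_coe b) h0
    have : 0 < ‖unitExp a - r * b‖ := by linarith
    positivity
  refine Continuous.mul (Continuous.div ?_ ?_ fun x => key _ _)
    (Continuous.div ?_ ?_ fun x => key _ _) <;> fun_prop

lemma integrable_periodMeasure_prod {f : ℝ × ℝ → ℂ} (hf : Continuous f) :
    Integrable f (periodMeasure.prod periodMeasure) := by
  rw [Measure.prod_restrict]
  exact (hf.continuousOn.integrableOn_compact (isCompact_Icc.prod isCompact_Icc)).mono_set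
    (prod_mono Ioc_subset_Icc_self Ioc_subset_Icc_self)

lemma integrable_prod_periodMeasure {f : Torus 2 × ℝ × ℝ → ℂ} (hf : Continuous f)
    (P : Measure (Torus 2)) [IsFiniteMeasure P] :
    Integrable f (P.prod (periodMeasure.prod periodMeasure)) := by
  have : P.prod (periodMeasure.prod periodMeasure) =
      (P.prod (volume.prod volume)).restrict
        (univ ×ˢ (Ioc 0 (2 * Real.pi) ×ˢ Ioc 0 (2 * Real.pi))) := by
    rw [← Measure.prod_restrict, ← Measure.prod_restrict, Measure.restrict_univ]
  rw [this]
  exact (hf.continuousOn.integrableOn_compact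
    (isCompact_univ.prod (isCompact_Icc.prod isCompact_Icc))).mono_set
    (prod_mono le_rfl (prod_mono Ioc_subset_Icc_self Ioc_subset_Icc_self))

lemma continuous_comp_unitExp {G : ℂ → ℂ} {R : ℝ} (hR : 1 < R)
    (hG : DifferentiableOn ℂ G (ball 0 R)) : Continuous fun a => G (unitExp a) := by
  refine hG.continuousOn.comp_continuous continuous_unitExp fun a => ?_
  simpa [norm_unitExp] using hR

lemma continuous_mul_conj_mul {X : Type*} [TopologicalSpace X] {G H : ℂ → ℂ}
    (hG : Continuous fun a => G (unitExp a)) (hH : Continuous fun a => H (unitExp a))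
    {q : X → ℝ × ℝ} (hq : Continuous q) {F : X → ℂ} (hF : Continuous F) :
    Continuous fun x => G (unitExp (q x).1) * conj (H (unitExp (q x).2)) * F x :=
  ((hG.comp (continuous_fst.comp hq)).mul
    (Complex.continuous_conj.comp (hH.comp (continuous_snd.comp hq)))).mul hF

/-- Since `|ζ - r e^{ia}| = |e^{ia} - r ζ|`, the Poisson kernel of `r e^{ia}` at `ζ` is also that of
`r ζ` at `e^{ia}`. After Fubini it therefore reproduces `G` and `conj H` at the points `r ζ`. -/
lemma integral_torus_eq_integral_poisson {G H : ℂ → ℂ} {R r : ℝ} (hR : 1 < R)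
    (hG : DifferentiableOn ℂ G (ball 0 R)) (hH : DifferentiableOn ℂ H (ball 0 R))
    (h0 : 0 ≤ r) (h1 : r < 1) (P : Measure (Torus 2)) [IsFiniteMeasure P] :
    (2 * Real.pi) ^ 2 * ∫ ζ, G (r * ζ 0) * conj (H (r * ζ 1)) ∂P =
      ∫ q, G (unitExp q.1) * conj (H (unitExp q.2)) *
        ((∫ ζ, poissonKernelPolydisc (bidiscPoint r q) ζ ∂P : ℝ) : ℂ)
        ∂(periodMeasure.prod periodMeasure) := by
  have hlt : ∀ b : Circle, ‖(r : ℂ) * b‖ < 1 := fun b => by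
    simp [abs_of_nonneg h0, h1, Circle.norm_coe]
  have hcG := continuous_comp_unitExp hR hG
  have hcH := continuous_comp_unitExp hR hH
  have hcK := continuous_poissonKernel_bidiscPoint h0 h1
  rw [← integral_const_mul]
  have step : ∀ ζ : Torus 2, (2 * Real.pi : ℂ) ^ 2 * (G (r * ζ 0) * conj (H (r * ζ 1))) =
      ∫ q : ℝ × ℝ, G (unitExp q.1) * conj (H (unitExp q.2)) *
        (poissonKernelPolydisc (bidiscPoint r q) ζ : ℂ) ∂(periodMeasure.prod periodMeasure) := by
    intro ζ
    have e1 := integral_poisson_mul hR hG (hlt (ζ 0))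
    have e2 := congrArg conj (integral_poisson_mul hR hH (hlt (ζ 1)))
    rw [← integral_conj] at e2
    simp only [map_mul, Complex.conj_ofReal, map_ofNat] at e2
    calc _ = (2 * Real.pi * G (r * ζ 0)) * (2 * Real.pi * conj (H (r * ζ 1))) := by ring
      _ = _ := by
        rw [← e1, ← e2, ← integral_prod_mul]
        refine integral_congr_ae (.of_forall fun q => ?_)
        simp only [poissonKernelPolydisc_bidiscPoint h0]
        push_cast
        ring
  simp only [step]
  rw [integral_integral_swap]
  · refine integral_congr_ae (.of_forall fun q => ?_)
    simp only
    rw [integral_const_mul, integral_complex_ofReal]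
  · apply integrable_prod_periodMeasure
    exact continuous_mul_conj_mul hcG hcH continuous_snd (Complex.continuous_ofReal.comp hcK)

/-- Write `Re f = (f + conj f) / 2`. The term with `f` is holomorphic in the first variable and
vanishes at its origin because `G 0 = 0`. The term with `conj f` is antiholomorphic in the second
and vanishes because `H 0 = 0`. Each has mean zero in that variable. -/
lemma integral_mul_re_eq_zero {f : (Fin 2 → ℂ) → ℂ} (hf : AnalyticOnNhd ℂ f (openPolydisc 2))
    {G H : ℂ → ℂ} {R r : ℝ} (hR : 1 < R)
    (hG : DifferentiableOn ℂ G (ball 0 R)) (hH : DifferentiableOn ℂ H (ball 0 R))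
    (hG0 : G 0 = 0) (hH0 : H 0 = 0) (h0 : 0 < r) (h1 : r < 1) :
    ∫ q, G (unitExp q.1) * conj (H (unitExp q.2)) * ((f (bidiscPoint r q)).re : ℂ)
        ∂(periodMeasure.prod periodMeasure) = 0 := by
  have hcG := continuous_comp_unitExp hR hG
  have hcH := continuous_comp_unitExp hR hH
  have hcf : Continuous fun q => f (bidiscPoint r q) :=
    hf.continuousOn.comp_continuous (continuous_bidiscPoint r) (bidiscPoint_mem h0.le h1)
  have hR' : 1 < min R r⁻¹ := lt_min hR ((one_lt_inv₀ h0).2 h1)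
  have hsmall : ∀ z ∈ ball (0 : ℂ) (min R r⁻¹), ‖(r : ℂ) * z‖ < 1 := fun z hz => by
    rw [mem_ball_zero_iff, lt_min_iff] at hz
    rw [norm_mul, Complex.norm_real, Real.norm_of_nonneg h0.le]
    calc r * ‖z‖ < r * r⁻¹ := by gcongr; exact hz.2
      _ = 1 := mul_inv_cancel₀ h0.ne'
  have hsub : ball (0 : ℂ) (min R r⁻¹) ⊆ ball 0 R := ball_subset_ball (min_le_left _ _)
  have i1 : Integrable (fun q => G (unitExp q.1) * conj (H (unitExp q.2)) * f (bidiscPoint r q))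
      (periodMeasure.prod periodMeasure) :=
    integrable_periodMeasure_prod (continuous_mul_conj_mul hcG hcH continuous_id hcf)
  have i2 : Integrable (fun q => G (unitExp q.1) * conj (H (unitExp q.2)) *
      conj (f (bidiscPoint r q))) (periodMeasure.prod periodMeasure) :=
    integrable_periodMeasure_prod (continuous_mul_conj_mul hcG hcH continuous_id
      (Complex.continuous_conj.comp hcf))
  have e1 : ∫ q, G (unitExp q.1) * conj (H (unitExp q.2)) * f (bidiscPoint r q)
      ∂(periodMeasure.prod periodMeasure) = 0 := by
    rw [integral_prod_symm _ i1]
    refine integral_eq_zero_of_ae (.of_forall fun b => ?_)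
    have := integral_unitExp_eq (g := fun z => G z * conj (H (unitExp b)) *
      f ![r * z, r * unitExp b]) hR' (by
        refine ((hG.mono hsub).mul_const _).mul fun z hz => ?_
        refine DifferentiableAt.differentiableWithinAt ?_
        refine DifferentiableAt.comp (g := f) z (hf _ ?_).differentiableAt ?_
        · intro j
          fin_cases j
          · simpa using hsmall z hz
          · simp [norm_unitExp, abs_of_pos h0, h1]
        · refine differentiableAt_pi.2 fun j => ?_
          fin_cases j
          · simp only [Fin.zero_eta, Matrix.cons_val_zero]; fun_prop
          · simp only [Fin.mk_one, Matrix.cons_val_one, Matrix.cons_val_zero]; fun_prop)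
    simpa [hG0, bidiscPoint] using this
  have e2 : ∫ q, G (unitExp q.1) * conj (H (unitExp q.2)) * conj (f (bidiscPoint r q))
      ∂(periodMeasure.prod periodMeasure) = 0 := by
    rw [integral_prod _ i2]
    refine integral_eq_zero_of_ae (.of_forall fun a => ?_)
    have := integral_unitExp_eq (g := fun z => conj (G (unitExp a)) * H z *
      f ![r * unitExp a, r * z]) hR' (by
        refine ((hH.mono hsub).const_mul _).mul fun z hz => ?_
        refine DifferentiableAt.differentiableWithinAt ?_
        refine DifferentiableAt.comp (g := f) z (hf _ ?_).differentiableAt ?_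
        · intro j
          fin_cases j
          · simp [norm_unitExp, abs_of_pos h0, h1]
          · simpa using hsmall z hz
        · refine differentiableAt_pi.2 fun j => ?_
          fin_cases j
          · simp only [Fin.zero_eta, Matrix.cons_val_zero]; fun_prop
          · simp only [Fin.mk_one, Matrix.cons_val_one, Matrix.cons_val_zero]; fun_prop)
    have := congrArg conj this
    rw [← integral_conj] at this
    simpa [hH0, bidiscPoint] using this
  have : ∀ q, G (unitExp q.1) * conj (H (unitExp q.2)) * ((f (bidiscPoint r q)).re : ℂ) =
      2⁻¹ * (G (unitExp q.1) * conj (H (unitExp q.2)) * f (bidiscPoint r q)) +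
      2⁻¹ * (G (unitExp q.1) * conj (H (unitExp q.2)) * conj (f (bidiscPoint r q))) := by
    intro q
    rw [Complex.re_eq_add_conj]
    ring
  simp only [this]
  rw [integral_add, integral_const_mul, integral_const_mul, e1, e2]
  · simp
  · exact i1.const_mul _
  · exact i2.const_mul _

lemma poissonIntegral_eq_sub (μ : SignedMeasure (Torus 2)) {r : ℝ} (h0 : 0 ≤ r) (h1 : r < 1)
    (q : ℝ × ℝ) :
    poissonIntegral μ (bidiscPoint r q) =
      ∫ ζ, poissonKernelPolydisc (bidiscPoint r q) ζ ∂μ.toJordanDecomposition.posPart -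
      ∫ ζ, poissonKernelPolydisc (bidiscPoint r q) ζ ∂μ.toJordanDecomposition.negPart := by
  have hc : Continuous (poissonKernelPolydisc (bidiscPoint r q)) :=
    Continuous.comp (f := fun ζ : Torus 2 => (ζ, q))
      (continuous_poissonKernel_bidiscPoint h0 h1) (by fun_prop)
  have hint : ∀ (P : Measure (Torus 2)) [IsFiniteMeasure P],
      Integrable (poissonKernelPolydisc (bidiscPoint r q)) P := fun P _ =>
    hc.integrable_of_hasCompactSupport (HasCompactSupport.of_compactSpace _)
  rw [poissonIntegral]
  conv_lhs => rw [← μ.toSignedMeasure_toJordanDecomposition, JordanDecomposition.toSignedMeasure]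
  rw [VectorMeasure.integral_sub_vectorMeasure, VectorMeasure.integral_toSignedMeasure,
    VectorMeasure.integral_toSignedMeasure]
  · unfold VectorMeasure.Integrable
    rw [Measure.variation_toSignedMeasure]
    exact hint _
  · unfold VectorMeasure.Integrable
    rw [Measure.variation_toSignedMeasure]
    exact hint _

/-- An RP-measure annihilates the products of a function analytic in the first variable and a
function antianalytic in the second one, both vanishing at the origin. -/
theorem IsRPMeasure.integral_mul_conj_eq {μ : SignedMeasure (Torus 2)} (hμ : IsRPMeasure μ)
    {g h : ℂ → ℂ} (hg : IsDiscTest g) (hh : IsDiscTest h) :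
    ∫ ζ, g (ζ 0) * conj (h (ζ 1)) ∂μ.toJordanDecomposition.posPart =
      ∫ ζ, g (ζ 0) * conj (h (ζ 1)) ∂μ.toJordanDecomposition.negPart := by
  obtain ⟨f, hf, hμf⟩ := hμ
  obtain ⟨⟨R₁, hR₁, hg⟩, hg0⟩ := hg
  obtain ⟨⟨R₂, hR₂, hh⟩, hh0⟩ := hh
  -- Dilating the test functions by `T > 1` and taking `r = 1/T` makes `G (r ζ) = g ζ` exactly, so
  -- no limit `r → 1` is needed.
  obtain ⟨T, hT1, hT⟩ := exists_between (lt_min hR₁ hR₂)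
  have hT0 : 0 < T := one_pos.trans hT1
  obtain ⟨hT₁, hT₂⟩ := lt_min_iff.1 hT
  set r : ℝ := T⁻¹ with hr
  have h0 : 0 < r := inv_pos.2 hT0
  have h1 : r < 1 := inv_lt_one_of_one_lt₀ hT1
  set R : ℝ := min R₁ R₂ / T with hRdef
  have hR : 1 < R := (one_lt_div hT0).2 hT
  have aux : ∀ {g : ℂ → ℂ} {R' : ℝ}, DifferentiableOn ℂ g (ball 0 R') → min R₁ R₂ ≤ R' →
      DifferentiableOn ℂ (fun z => g (T * z)) (ball 0 R) := by
    intro g R' hg hle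
    refine hg.comp (by fun_prop) fun z hz => ?_
    rw [mem_ball_zero_iff] at hz ⊢
    rw [norm_mul, Complex.norm_real, Real.norm_of_nonneg hT0.le]
    rw [hRdef, lt_div_iff₀ hT0] at hz
    linarith
  have hG := aux hg (min_le_left _ _)
  have hH := aux hh (min_le_right _ _)
  have key := integral_mul_re_eq_zero hf hR hG hH (by simpa using hg0) (by simpa using hh0) h0 h1
  have hK : ∀ (P : Measure (Torus 2)) [IsFiniteMeasure P], Integrable (fun q : ℝ × ℝ =>
      g (T * unitExp q.1) * conj (h (T * unitExp q.2)) *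
        ((∫ ζ, poissonKernelPolydisc (bidiscPoint r q) ζ ∂P : ℝ) : ℂ))
      (periodMeasure.prod periodMeasure) := by
    intro P _
    have hcG := continuous_comp_unitExp hR hG
    have hcH := continuous_comp_unitExp hR hH
    have hcK := continuous_poissonKernel_bidiscPoint h0.le h1
    have := (integrable_prod_periodMeasure
      (continuous_mul_conj_mul (G := fun z => g (T * z)) (H := fun z => h (T * z)) hcG hcH
        continuous_snd (Complex.continuous_ofReal.comp hcK)) P).integral_prod_right
    refine this.congr (.of_forall fun q => ?_)
    simp only
    rw [integral_const_mul, ← integral_complex_ofReal]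
    rfl
  have hrw : ∀ z : ℂ, (T : ℂ) * (r * z) = z := fun z => by
    rw [hr]; push_cast
    have : (T : ℂ) ≠ 0 := by exact_mod_cast hT0.ne'
    field_simp
  have eP := integral_torus_eq_integral_poisson hR hG hH h0.le h1 μ.toJordanDecomposition.posPart
  have eN := integral_torus_eq_integral_poisson hR hG hH h0.le h1 μ.toJordanDecomposition.negPart
  simp only [hrw] at eP eN
  have hpi : ((2 : ℂ) * Real.pi) ^ 2 ≠ 0 := by
    have : (Real.pi : ℂ) ≠ 0 := by exact_mod_cast Real.pi_ne_zero
    simp [this]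
  refine mul_left_cancel₀ hpi ?_
  rw [eP, eN, ← sub_eq_zero, ← integral_sub (hK _) (hK _), ← key]
  refine integral_congr_ae (.of_forall fun q => ?_)
  simp only
  rw [← hμf _ (bidiscPoint_mem h0.le h1 q), poissonIntegral_eq_sub μ h0.le h1]
  push_cast
  ring

/-! ### Peak functions for compact null sets of the circle. -/

lemma unitExp_add (s t : ℝ) : unitExp (s + t) = unitExp s * unitExp t := by
  simp only [unitExp, ← Complex.exp_add]; push_cast; ring_nf

lemma unitExp_eq_one_iff {t : ℝ} (ht : |t| < 2 * Real.pi) : unitExp t = 1 ↔ t = 0 := by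
  refine ⟨fun h => ?_, fun h => by simp [h, unitExp]⟩
  rw [unitExp, Complex.exp_eq_one_iff] at h
  obtain ⟨n, hn⟩ := h
  have h1 : t = n * (2 * Real.pi) := by
    have : (t : ℂ) * Complex.I = ((n * (2 * Real.pi) : ℝ) : ℂ) * Complex.I := by
      rw [hn]; push_cast; ring
    exact_mod_cast mul_right_cancel₀ Complex.I_ne_zero this
  have hpi := Real.pi_pos
  have h2 : |(n : ℝ)| < 1 := by
    rw [h1, abs_mul, abs_of_pos (by positivity : 0 < 2 * Real.pi)] at ht
    by_contra hc
    push Not at hc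
    nlinarith
  have h3 : n = 0 := by
    have : |n| < 1 := by exact_mod_cast h2
    simpa using Int.abs_lt_one_iff.1 this
  simp [h1, h3]

lemma norm_one_sub_unitExp_le (t : ℝ) : ‖1 - unitExp t‖ ≤ |t| := by
  rw [norm_sub_rev, unitExp, mul_comm]
  simpa using Real.norm_exp_I_mul_ofReal_sub_one_le (x := t)

lemma norm_unitExp_sub_unitExp_le (s t : ℝ) : ‖unitExp s - unitExp t‖ ≤ |t - s| := by
  have : unitExp s - unitExp t = unitExp s * (1 - unitExp (t - s)) := by
    rw [mul_sub, ← unitExp_add]; simp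
  rw [this, norm_mul, norm_unitExp, one_mul]
  exact norm_one_sub_unitExp_le _

lemma unitExp_re (t : ℝ) : (unitExp t).re = Real.cos t := Complex.exp_ofReal_mul_I_re t

lemma unitExp_im (t : ℝ) : (unitExp t).im = Real.sin t := Complex.exp_ofReal_mul_I_im t

/-- The Cauchy type integral of the indicator function of a set of angles, with poles pushed out of
the closed unit disc. -/
noncomputable def cauchyIndicator (A : Set ℝ) (d : ℝ) (z : ℂ) : ℂ :=
  ∫ s in A, (1 + d - z * unitExp (-s))⁻¹

lemma sub_norm_le_re_sub {d : ℝ} (z : ℂ) (s : ℝ) :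
    1 + d - ‖z‖ ≤ (1 + d - z * unitExp (-s)).re := by
  have := Complex.re_le_norm (z * unitExp (-s))
  rw [norm_mul, norm_unitExp, mul_one] at this
  simp only [Complex.sub_re, Complex.add_re, Complex.one_re, Complex.ofReal_re]
  linarith

lemma sub_norm_le_norm_sub {d : ℝ} (z : ℂ) (s : ℝ) :
    1 + d - ‖z‖ ≤ ‖1 + d - z * unitExp (-s)‖ :=
  (sub_norm_le_re_sub z s).trans (Complex.re_le_norm _)

lemma integrable_cauchyIndicator {A : Set ℝ} (hA : volume A ≠ ⊤) {d : ℝ} {z : ℂ}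
    (hz : ‖z‖ < 1 + d) : IntegrableOn (fun s => (1 + d - z * unitExp (-s))⁻¹) A := by
  have hpos : 0 < 1 + d - ‖z‖ := by linarith
  have : IsFiniteMeasure (volume.restrict A) := ⟨by simpa using hA.lt_top⟩
  refine Integrable.of_bound (C := (1 + d - ‖z‖)⁻¹)
    (Measurable.aestronglyMeasurable (by fun_prop)) (.of_forall fun s => ?_)
  rw [norm_inv]
  exact inv_anti₀ hpos (sub_norm_le_norm_sub z s)

lemma differentiableOn_cauchyIndicator {A : Set ℝ} (hA : volume A ≠ ⊤) (d : ℝ) :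
    DifferentiableOn ℂ (cauchyIndicator A d) (ball 0 (1 + d)) := by
  intro z hz
  rw [mem_ball_zero_iff] at hz
  have : IsFiniteMeasure (volume.restrict A) := ⟨by simpa using hA.lt_top⟩
  set η := (1 + d - ‖z‖) / 2 with hη
  have hη0 : 0 < η := by rw [hη]; linarith
  have hlow : ∀ x ∈ ball z η, ∀ s : ℝ, η ≤ ‖1 + d - x * unitExp (-s)‖ := fun x hx s => by
    refine le_trans ?_ (sub_norm_le_norm_sub x s)
    have h1 := norm_sub_norm_le x z
    rw [mem_ball, dist_eq_norm] at hx
    linarith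
  have := hasDerivAt_integral_of_dominated_loc_of_deriv_le (μ := volume.restrict A)
    (F := fun z s => (1 + d - z * unitExp (-s))⁻¹) (x₀ := z) (s := ball z η)
    (F' := fun z s => unitExp (-s) / (1 + d - z * unitExp (-s)) ^ 2)
    (bound := fun _ => 1 / η ^ 2) (ball_mem_nhds z hη0)
    (.of_forall fun x => Measurable.aestronglyMeasurable (by fun_prop))
    (integrable_cauchyIndicator hA hz)
    (Measurable.aestronglyMeasurable (by fun_prop))
    (.of_forall fun s x hx => by
      rw [norm_div, norm_unitExp, norm_pow]
      have := hlow x hx s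
      gcongr)
    (integrable_const _)
    (.of_forall fun s x hx => by
      have h0 : 1 + d - x * unitExp (-s) ≠ 0 := by
        rw [← norm_pos_iff]; exact hη0.trans_le (hlow x hx s)
      have h1 : HasDerivAt (fun x : ℂ => 1 + d - x * unitExp (-s)) (-unitExp (-s)) x := by
        simpa using ((hasDerivAt_id x).mul_const (unitExp (-s))).const_sub (1 + d : ℂ)
      simpa using h1.fun_inv h0)
  exact this.2.differentiableAt.differentiableWithinAt

lemma re_inv_nonneg {w : ℂ} (hw : 0 ≤ w.re) : 0 ≤ (w⁻¹).re := by
  rw [Complex.inv_re]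
  exact div_nonneg hw (Complex.normSq_nonneg _)

lemma re_cauchyIndicator {A : Set ℝ} (hA : volume A ≠ ⊤) {d : ℝ} {z : ℂ} (hz : ‖z‖ < 1 + d) :
    (cauchyIndicator A d z).re = ∫ s in A, ((1 + d - z * unitExp (-s))⁻¹).re :=
  (integral_re (integrable_cauchyIndicator hA hz)).symm

lemma re_cauchyIndicator_nonneg {A : Set ℝ} (hA : volume A ≠ ⊤) {d : ℝ} {z : ℂ}
    (hz : ‖z‖ < 1 + d) : 0 ≤ (cauchyIndicator A d z).re := by
  rw [re_cauchyIndicator hA hz]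
  refine integral_nonneg fun s => re_inv_nonneg ?_
  have := sub_norm_le_re_sub (d := d) z s
  linarith

lemma norm_cauchyIndicator_le {A : Set ℝ} (hA : volume A ≠ ⊤) {d η : ℝ} {z : ℂ} (hη : 0 < η)
    (h : ∀ s ∈ A, η ≤ ‖1 + d - z * unitExp (-s)‖) :
    ‖cauchyIndicator A d z‖ ≤ η⁻¹ * volume.real A :=
  norm_setIntegral_le_of_norm_le_const hA.lt_top fun s hs => by
    rw [norm_inv]
    exact inv_anti₀ hη (h s hs)

/-- For `|s - x| ≤ d` the denominator has real part at least `d` and modulus at most `2d`, so its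
inverse has real part at least `1/(4d)`. This is integrated over an interval of length `2d`. -/
lemma half_le_re_cauchyIndicator {A : Set ℝ} (hA : volume A ≠ ⊤)
    {d x : ℝ} (hd : 0 < d) (hx : closedBall x d ⊆ A) :
    1 / 2 ≤ (cauchyIndicator A d (unitExp x)).re := by
  have hz : ‖unitExp x‖ < 1 + d := by rw [norm_unitExp]; linarith
  have hpos : ∀ s, d ≤ (1 + d - unitExp x * unitExp (-s)).re := fun s => by
    have := sub_norm_le_re_sub (d := d) (unitExp x) s
    rw [norm_unitExp] at this
    linarith
  rw [re_cauchyIndicator hA hz]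
  calc (1 : ℝ) / 2 = ∫ s in closedBall x d, 1 / (4 * d) := by
        rw [setIntegral_const, Measure.real, Real.volume_closedBall,
          ENNReal.toReal_ofReal (by positivity)]
        simp only [smul_eq_mul]
        field_simp
        norm_num
    _ ≤ ∫ s in closedBall x d, ((1 + d - unitExp x * unitExp (-s))⁻¹).re := by
        refine setIntegral_mono_on (integrableOn_const measure_closedBall_lt_top.ne) ((integrable_cauchyIndicator hA hz).mono_set hx).re
          measurableSet_closedBall fun s hs => ?_
        have h1 : ‖1 + d - unitExp x * unitExp (-s)‖ ≤ 2 * d := by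
          have e : 1 + d - unitExp x * unitExp (-s) = d + (1 - unitExp (x - s)) := by
            rw [unitExp_sub]; ring
          have h2 := norm_one_sub_unitExp_le (x - s)
          rw [mem_closedBall, dist_comm, Real.dist_eq] at hs
          rw [e]
          refine (norm_add_le _ _).trans ?_
          rw [Complex.norm_real, Real.norm_of_nonneg hd.le]
          linarith
        rw [Complex.inv_re, Complex.normSq_eq_norm_sq]
        have h3 := hpos s
        have h4 : 0 < ‖1 + d - unitExp x * unitExp (-s)‖ :=
          hd.trans_le (h3.trans (Complex.re_le_norm _))
        rw [div_le_div_iff₀ (by positivity) (by positivity)]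
        nlinarith
    _ ≤ _ := by
        refine setIntegral_mono_set (integrable_cauchyIndicator hA hz).re
          (.of_forall fun s => re_inv_nonneg (hd.le.trans (hpos s))) (.of_forall hx)

/-- The map `w ↦ w/(1+w)` sends the right half plane into the unit disc, is small with `w`, and is
close to `1` when `Re w` is large. This turns a large real part on a set into a peak function. -/
lemma norm_one_add_ge_one {w : ℂ} (hw : 0 ≤ w.re) : 1 ≤ ‖1 + w‖ := by
  have := Complex.re_le_norm (1 + w)
  simp at this
  linarith

lemma norm_div_one_add_le_norm {w : ℂ} (hw : 0 ≤ w.re) : ‖w / (1 + w)‖ ≤ ‖w‖ := by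
  rw [norm_div]
  exact div_le_self (norm_nonneg _) (norm_one_add_ge_one hw)

lemma norm_div_one_add_le_one {w : ℂ} (hw : 0 ≤ w.re) : ‖w / (1 + w)‖ ≤ 1 := by
  rw [norm_div]
  refine div_le_one_of_le₀ ?_ (norm_nonneg _)
  rw [← sq_le_sq₀ (norm_nonneg _) (norm_nonneg _), ← Complex.normSq_eq_norm_sq,
    ← Complex.normSq_eq_norm_sq, Complex.normSq_apply, Complex.normSq_apply]
  simp
  nlinarith

lemma norm_one_sub_div_one_add_le {w : ℂ} {c : ℝ} (hc : 0 < c) (hw : c ≤ w.re) :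
    ‖1 - w / (1 + w)‖ ≤ c⁻¹ := by
  have h1 := norm_one_add_ge_one (hc.le.trans hw)
  have h0 : 1 + w ≠ 0 := by rw [← norm_pos_iff]; linarith
  have e : 1 - w / (1 + w) = (1 + w)⁻¹ := by field_simp; ring
  rw [e, norm_inv]
  refine inv_anti₀ hc ?_
  have := Complex.re_le_norm (1 + w)
  simp at this
  linarith

/-- A compact null set of angles is the peak set, in the sense of bounded pointwise convergence, of
a sequence of functions holomorphic near the closed disc. -/
lemma exists_tendsto_indicator {C : Set ℝ} (hC : IsCompact C) (h0 : volume C = 0)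
    (hsub : C ⊆ Ioo (-Real.pi) Real.pi) :
    ∃ g : ℕ → ℂ → ℂ, (∀ k, IsDiscTest (g k)) ∧ (∀ k x, ‖g k (unitExp x)‖ ≤ 2) ∧
      ∀ x ∈ Ioc (-Real.pi) Real.pi,
        Tendsto (fun k => g k (unitExp x)) atTop (𝓝 (C.indicator 1 x)) := by
  rcases C.eq_empty_or_nonempty with rfl | hne
  · refine ⟨fun _ _ => 0, fun k => ⟨⟨2, by norm_num, differentiableOn_const _⟩, rfl⟩,
      by simp, by simp⟩
  set d : ℕ → ℝ := fun k => 1 / ((k : ℝ) + 1) with hd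
  have hd0 : ∀ k, 0 < d k := fun k => by simp only [hd]; positivity
  have hdlim : Tendsto d atTop (𝓝 0) := tendsto_one_div_add_atTop_nhds_zero_nat
  set A : ℕ → Set ℝ := fun k => cthickening (d k) C with hAdef
  have hA : ∀ k, volume (A k) ≠ ⊤ := fun k => hC.cthickening.measure_lt_top.ne
  set V : ℕ → ℝ := fun k => volume.real (A k) with hV
  have hVlim : Tendsto V atTop (𝓝 0) := by
    have := (tendsto_measure_cthickening_of_isCompact (μ := volume) hC).comp hdlim
    rw [h0] at this
    exact (ENNReal.tendsto_toReal ENNReal.zero_ne_top).comp this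
  have hball : ∀ k, ∀ x ∈ C, closedBall x (d k) ⊆ A k := fun k x hx =>
    closedBall_subset_cthickening hx _
  have hV0 : ∀ k, 0 < V k := fun k => by
    obtain ⟨x, hx⟩ := hne
    refine ENNReal.toReal_pos (ne_of_gt ?_) (hA k)
    refine lt_of_lt_of_le ?_ (measure_mono (hball k x hx))
    rw [Real.volume_closedBall]
    simpa using hd0 k
  -- The scaling balances two demands: `M → ∞` forces peaking on `C`, while `M V = √V → 0` forces
  -- decay at the origin and at angles outside `C`.
  set M : ℕ → ℝ := fun k => (Real.sqrt (V k))⁻¹ with hM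
  have hM0 : ∀ k, 0 < M k := fun k => inv_pos.2 (Real.sqrt_pos.2 (hV0 k))
  have hMV : ∀ k, M k * V k = Real.sqrt (V k) := fun k => by
    simp only [hM]
    rw [inv_mul_eq_div, Real.div_sqrt]
  have hsqrt : Tendsto (fun k => Real.sqrt (V k)) atTop (𝓝 0) := by
    simpa using hVlim.sqrt
  set w : ℕ → ℂ → ℂ := fun k z => M k * cauchyIndicator (A k) (d k) z with hw
  have hwre : ∀ k z, ‖z‖ < 1 + d k → 0 ≤ (w k z).re := fun k z hz => by
    simp only [hw, Complex.re_ofReal_mul]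
    exact mul_nonneg (hM0 k).le (re_cauchyIndicator_nonneg (hA k) hz)
  have hwnorm : ∀ k z, ‖w k z‖ = M k * ‖cauchyIndicator (A k) (d k) z‖ := fun k z => by
    simp only [hw, norm_mul, Complex.norm_real, Real.norm_of_nonneg (hM0 k).le]
  set f : ℕ → ℂ → ℂ := fun k z => w k z / (1 + w k z) with hf
  have hfdiff : ∀ k, DifferentiableOn ℂ (f k) (ball 0 (1 + d k)) := fun k => by
    have h1 : DifferentiableOn ℂ (w k) (ball 0 (1 + d k)) :=
      (differentiableOn_cauchyIndicator (hA k) (d k)).const_mul _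
    refine h1.div (h1.const_add _) fun z hz => ?_
    rw [← norm_pos_iff]
    have := norm_one_add_ge_one (hwre k z (by simpa using hz))
    linarith
  have hnz : ∀ k, ‖(0 : ℂ)‖ < 1 + d k := fun k => by simp; linarith [hd0 k]
  have hne1 : ∀ k x, ‖unitExp x‖ < 1 + d k := fun k x => by rw [norm_unitExp]; linarith [hd0 k]
  have hf0 : Tendsto (fun k => f k 0) atTop (𝓝 0) := by
    refine squeeze_zero_norm (fun k => ?_) hsqrt
    refine (norm_div_one_add_le_norm (hwre k 0 (hnz k))).trans ?_
    rw [hwnorm, ← hMV]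
    refine mul_le_mul_of_nonneg_left ?_ (hM0 k).le
    have := norm_cauchyIndicator_le (hA k) (d := d k) (z := 0) one_pos fun s _ => by
      have := sub_norm_le_norm_sub (d := d k) 0 s
      refine le_trans ?_ this
      simp [(hd0 k).le]
    simpa using this
  -- Subtracting the value at `0` makes the function vanish there. It costs nothing in the limit and
  -- raises the bound from `1` to `2`.
  refine ⟨fun k z => f k z - f k 0, fun k => ⟨⟨1 + d k, by linarith [hd0 k],
    (hfdiff k).sub_const _⟩, sub_self _⟩, fun k x => ?_, fun x hx => ?_⟩
  · refine (norm_sub_le _ _).trans ?_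
    have h1 := norm_div_one_add_le_one (hwre k _ (hne1 k x))
    have h2 := norm_div_one_add_le_one (hwre k 0 (hnz k))
    simp only [hf]
    linarith
  · rw [← sub_zero (C.indicator 1 x)]
    refine Tendsto.sub ?_ hf0
    by_cases hxC : x ∈ C
    · rw [indicator_of_mem hxC, Pi.one_apply, tendsto_iff_norm_sub_tendsto_zero]
      refine squeeze_zero (fun _ => norm_nonneg _) (fun k => ?_)
        (by simpa using hsqrt.const_mul 2)
      rw [norm_sub_rev]
      have h1 := norm_one_sub_div_one_add_le (w := w k (unitExp x)) (c := M k * (1 / 2))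
        (by have := hM0 k; positivity) (by
          simp only [hw, Complex.re_ofReal_mul]
          exact mul_le_mul_of_nonneg_left
            (half_le_re_cauchyIndicator (hA k) (hd0 k) (hball k x hxC)) (hM0 k).le)
      refine h1.trans_eq ?_
      simp only [hM]
      rw [mul_inv, inv_inv]
      ring
    · rw [indicator_of_notMem hxC]
      -- Compactness gives `e^{ix}` a positive distance `η` from the arc set. Positivity holds
      -- because angles differing by less than `2π` are equal if they give the same point.
      have hcont : Continuous fun s => ‖1 - unitExp (x - s)‖ := by fun_prop
      obtain ⟨s₀, hs₀, hmin⟩ := hC.exists_isMinOn hne hcont.continuousOn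
      set η := ‖1 - unitExp (x - s₀)‖ with hη
      have hη0 : 0 < η := by
        rw [hη, norm_pos_iff, sub_ne_zero]
        intro h
        have h1 := hsub hs₀
        have := (unitExp_eq_one_iff (t := x - s₀) (by
          rw [abs_lt]; constructor <;> linarith [hx.1, hx.2, h1.1, h1.2])).1 h.symm
        exact hxC (by rwa [sub_eq_zero.1 this])
      refine squeeze_zero_norm' ?_ (by simpa using hsqrt.const_mul (2 / η))
      filter_upwards [hdlim.eventually (gt_mem_nhds (by positivity : 0 < η / 4))] with k hk
      refine (norm_div_one_add_le_norm (hwre k _ (hne1 k x))).trans ?_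
      rw [hwnorm, ← hMV]
      have := norm_cauchyIndicator_le (hA k) (d := d k) (z := unitExp x)
        (by positivity : 0 < η / 2) fun s hs => by
          change s ∈ cthickening (d k) C at hs
          rw [hC.cthickening_eq_biUnion_closedBall (hd0 k).le] at hs
          simp only [mem_iUnion, mem_closedBall, Real.dist_eq] at hs
          obtain ⟨s', hs', hss⟩ := hs
          have h1 : η ≤ ‖1 - unitExp (x - s')‖ := hmin hs'
          have h2 := norm_unitExp_sub_unitExp_le (x - s) (x - s')
          have h3 : |x - s' - (x - s)| ≤ d k := by simpa using hss
          have e : 1 - unitExp (x - s') = (1 + d k - unitExp x * unitExp (-s)) +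
              ((unitExp (x - s) - unitExp (x - s')) - (d k : ℂ)) := by
            rw [unitExp_sub x s]; ring
          rw [e] at h1
          have h4 := norm_add_le (1 + d k - unitExp x * unitExp (-s))
              ((unitExp (x - s) - unitExp (x - s')) - (d k : ℂ))
          have h5 := norm_sub_le (unitExp (x - s) - unitExp (x - s')) (d k : ℂ)
          rw [Complex.norm_real, Real.norm_of_nonneg (hd0 k).le] at h5
          linarith
      calc M k * ‖cauchyIndicator (A k) (d k) (unitExp x)‖
          ≤ M k * ((η / 2)⁻¹ * V k) := mul_le_mul_of_nonneg_left this (hM0 k).le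
        _ = _ := by field_simp

lemma IsDiscTest.mul_const_left {g : ℂ → ℂ} (hg : IsDiscTest g) {w : ℂ} (hw : ‖w‖ = 1) :
    IsDiscTest fun z => g (z * w) := by
  obtain ⟨⟨R, hR, h⟩, h0⟩ := hg
  refine ⟨⟨R, hR, h.comp (by fun_prop) fun z hz => ?_⟩, by simpa using h0⟩
  simpa [hw] using hz

lemma IsDiscTest.continuous_unitExp {g : ℂ → ℂ} (hg : IsDiscTest g) :
    Continuous fun a => g (unitExp a) := by
  obtain ⟨⟨R, hR, h⟩, h0⟩ := hg
  exact continuous_comp_unitExp hR h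

lemma IsDiscTest.exists_bound {g : ℂ → ℂ} (hg : IsDiscTest g) :
    ∃ M, 0 ≤ M ∧ ∀ a, ‖g (unitExp a)‖ ≤ M := by
  obtain ⟨⟨R, hR, h⟩, h0⟩ := hg
  obtain ⟨M, hM⟩ := (isCompact_closedBall (0 : ℂ) 1).exists_bound_of_continuousOn
    (h.continuousOn.mono (closedBall_subset_ball hR))
  exact ⟨M, (norm_nonneg _).trans (hM 0 (by simp)), fun a => hM _ (by simp [norm_unitExp])⟩

/-! ### Measurable graphs over Lebesgue null sets. -/

/-- Two measures on the plane, carried by a period square of the torus, whose difference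
annihilates the functions analytic in the first variable and antianalytic in the second one. -/
structure IsRPPair (P N : Measure (ℝ × ℝ)) : Prop where
  mem_left : ∀ᵐ p ∂P, p.1 ∈ Ioc (-Real.pi) Real.pi ∧ p.2 ∈ Ioc (-Real.pi) Real.pi
  mem_right : ∀ᵐ p ∂N, p.1 ∈ Ioc (-Real.pi) Real.pi ∧ p.2 ∈ Ioc (-Real.pi) Real.pi
  integral_eq : ∀ g h : ℂ → ℂ, IsDiscTest g → IsDiscTest h →
    ∫ p, g (unitExp p.1) * conj (h (unitExp p.2)) ∂P =
      ∫ p, g (unitExp p.1) * conj (h (unitExp p.2)) ∂N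

namespace IsRPPair

variable {P N : Measure (ℝ × ℝ)}

/-- Complex conjugation exchanges the roles of `g` and `h`. -/
lemma swap (hPN : IsRPPair P N) : IsRPPair (P.map Prod.swap) (N.map Prod.swap) := by
  refine ⟨?_, ?_, fun g h hg hh => ?_⟩
  · exact (MeasurableEquiv.prodComm.measurableEmbedding.ae_map_iff).2
      (hPN.mem_left.mono fun p hp => ⟨hp.2, hp.1⟩)
  · exact (MeasurableEquiv.prodComm.measurableEmbedding.ae_map_iff).2
      (hPN.mem_right.mono fun p hp => ⟨hp.2, hp.1⟩)
  · have aux : ∀ Q : Measure (ℝ × ℝ),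
        ∫ p, g (unitExp p.1) * conj (h (unitExp p.2)) ∂(Q.map Prod.swap) =
          conj (∫ p, h (unitExp p.1) * conj (g (unitExp p.2)) ∂Q) := fun Q => by
      rw [MeasurableEquiv.prodComm.measurableEmbedding.integral_map (f := Prod.swap),
        ← integral_conj]
      refine integral_congr_ae (.of_forall fun p => ?_)
      simp [mul_comm]
    rw [aux, aux, hPN.integral_eq h g hh hg]

variable [IsFiniteMeasure P] [IsFiniteMeasure N]

/-- The peak functions of `C` are put in place of `g`, and dominated convergence turns them into the
restriction to `C`. -/
lemma setIntegral_eq_of_isCompact (hPN : IsRPPair P N) {C : Set ℝ} (hC : IsCompact C)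
    (h0 : volume C = 0) (hsub : C ⊆ Ioo (-Real.pi) Real.pi) {h : ℂ → ℂ} (hh : IsDiscTest h) :
    ∫ p in Prod.fst ⁻¹' C, conj (h (unitExp p.2)) ∂P =
      ∫ p in Prod.fst ⁻¹' C, conj (h (unitExp p.2)) ∂N := by
  obtain ⟨g, hg, hg2, hlim⟩ := exists_tendsto_indicator hC h0 hsub
  obtain ⟨M, hM0, hM⟩ := hh.exists_bound
  have hmeas : MeasurableSet (Prod.fst ⁻¹' C : Set (ℝ × ℝ)) := measurable_fst hC.measurableSet
  have key : ∀ Q : Measure (ℝ × ℝ), IsFiniteMeasure Q →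
      (∀ᵐ p ∂Q, p.1 ∈ Ioc (-Real.pi) Real.pi ∧ p.2 ∈ Ioc (-Real.pi) Real.pi) →
      Tendsto (fun k => ∫ p, g k (unitExp p.1) * conj (h (unitExp p.2)) ∂Q) atTop
        (𝓝 (∫ p in Prod.fst ⁻¹' C, conj (h (unitExp p.2)) ∂Q)) := by
    intro Q _ hQ
    rw [← integral_indicator hmeas]
    refine tendsto_integral_of_dominated_convergence (fun _ => 2 * M) (fun k => ?_)
      (integrable_const _) (fun k => .of_forall fun p => ?_) ?_
    · exact (((hg k).continuous_unitExp.comp continuous_fst).mul (Complex.continuous_conj.comp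
        (hh.continuous_unitExp.comp continuous_snd))).aestronglyMeasurable
    · rw [norm_mul, RCLike.norm_conj]
      exact mul_le_mul (hg2 k _) (hM _) (norm_nonneg _) (by norm_num)
    · filter_upwards [hQ] with p hp
      have := (hlim p.1 hp.1).mul_const (conj (h (unitExp p.2)))
      convert this using 2
      by_cases hpC : p.1 ∈ C
      · rw [indicator_of_mem hpC, indicator_of_mem (by exact hpC)]; simp
      · rw [indicator_of_notMem hpC, indicator_of_notMem (by exact hpC)]; simp
  refine tendsto_nhds_unique (key P inferInstance hPN.mem_left) ?_
  simp only [hPN.integral_eq _ h (hg _) hh]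
  exact key N inferInstance hPN.mem_right

lemma setIntegral_eq_of_measurableSet (hPN : IsRPPair P N) {B : Set ℝ} (hB : MeasurableSet B)
    (h0 : volume B = 0) (hsub : B ⊆ Ioo (-Real.pi) Real.pi) {h : ℂ → ℂ} (hh : IsDiscTest h) :
    ∫ p in Prod.fst ⁻¹' B, conj (h (unitExp p.2)) ∂P =
      ∫ p in Prod.fst ⁻¹' B, conj (h (unitExp p.2)) ∂N := by
  obtain ⟨M, hM0, hM⟩ := hh.exists_bound
  refine eq_of_forall_dist_le fun ε hε => ?_
  obtain ⟨η, hη, hηε⟩ : ∃ η > 0, 2 * (M * η) ≤ ε := by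
    refine ⟨ε / (2 * (M + 1)), by positivity, ?_⟩
    rw [show 2 * (M * (ε / (2 * (M + 1)))) = ε * (M / (M + 1)) by field_simp]
    exact mul_le_of_le_one_right hε.le (div_le_one_of_le₀ (by linarith) (by linarith))
  -- Inner regularity is applied to the first marginal of `P + N`, so that one compact set serves
  -- both measures.
  obtain ⟨K, hKB, hK, hKη⟩ := hB.exists_isCompact_sdiff_lt (μ := (P + N).map Prod.fst)
    (measure_ne_top _ _) (ε := ENNReal.ofReal η) (by simpa using hη)
  rw [Measure.map_apply measurable_fst (hB.diff hK.measurableSet)] at hKη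
  have hKm : MeasurableSet (Prod.fst ⁻¹' K : Set (ℝ × ℝ)) := measurable_fst hK.measurableSet
  have hBm : MeasurableSet (Prod.fst ⁻¹' B : Set (ℝ × ℝ)) := measurable_fst hB
  have key : ∀ Q : Measure (ℝ × ℝ), IsFiniteMeasure Q → Q ≤ P + N →
      dist (∫ p in Prod.fst ⁻¹' B, conj (h (unitExp p.2)) ∂Q)
        (∫ p in Prod.fst ⁻¹' K, conj (h (unitExp p.2)) ∂Q) ≤ M * η := by
    intro Q _ hQ
    have hi : Integrable (fun p : ℝ × ℝ => conj (h (unitExp p.2))) Q :=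
      Integrable.of_bound (C := M) (Complex.continuous_conj.comp
        (hh.continuous_unitExp.comp continuous_snd)).aestronglyMeasurable
        (.of_forall fun p => by rw [RCLike.norm_conj]; exact hM _)
    rw [dist_eq_norm, ← setIntegral_sdiff hKm hi.integrableOn (preimage_mono hKB)]
    refine (norm_setIntegral_le_of_norm_le_const (measure_lt_top _ _) (C := M) fun p _ => ?_).trans
      ?_
    · rw [RCLike.norm_conj]; exact hM _
    · refine mul_le_mul_of_nonneg_left ?_ hM0
      refine ENNReal.toReal_le_of_le_ofReal hη.le ?_
      exact (hQ _).trans hKη.le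
  have hN := key N inferInstance (Measure.le_add_left le_rfl)
  have hP := key P inferInstance (Measure.le_add_right le_rfl)
  rw [hPN.setIntegral_eq_of_isCompact hK (measure_mono_null hKB h0) (hKB.trans hsub) hh] at hP
  calc _ ≤ _ := dist_triangle_right _ _ _
    _ ≤ M * η + M * η := add_le_add hP hN
    _ ≤ ε := by linarith

/-- A constant rotation is absorbed into `h`. For a simple function `θ` this is done on each level
set, which is again null, and a measurable `θ` is a pointwise limit of simple ones. -/
lemma setIntegral_shift_eq (hPN : IsRPPair P N) {B : Set ℝ} (hB : MeasurableSet B)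
    (h0 : volume B = 0) (hsub : B ⊆ Ioo (-Real.pi) Real.pi) {h : ℂ → ℂ} (hh : IsDiscTest h)
    {θ : ℝ → ℝ} (hθ : Measurable θ) :
    ∫ p in Prod.fst ⁻¹' B, conj (h (unitExp (p.2 - θ p.1))) ∂P =
      ∫ p in Prod.fst ⁻¹' B, conj (h (unitExp (p.2 - θ p.1))) ∂N := by
  obtain ⟨M, hM0, hM⟩ := hh.exists_bound
  set a := hθ.stronglyMeasurable.approx with ha
  have hc : Continuous fun t => conj (h (unitExp t)) :=
    Complex.continuous_conj.comp hh.continuous_unitExp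
  have hm : ∀ (θ : ℝ → ℝ), Measurable θ →
      Measurable fun p : ℝ × ℝ => conj (h (unitExp (p.2 - θ p.1))) := fun θ hθ =>
    hc.measurable.comp (measurable_snd.sub (hθ.comp measurable_fst))
  have hlim : ∀ Q : Measure (ℝ × ℝ), IsFiniteMeasure Q →
      Tendsto (fun k => ∫ p in Prod.fst ⁻¹' B, conj (h (unitExp (p.2 - a k p.1))) ∂Q) atTop
        (𝓝 (∫ p in Prod.fst ⁻¹' B, conj (h (unitExp (p.2 - θ p.1))) ∂Q)) := by
    intro Q _
    refine tendsto_integral_of_dominated_convergence (fun _ => M)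
      (fun k => (hm _ (a k).measurable).aestronglyMeasurable)
      (integrable_const _) (fun k => .of_forall fun p => ?_) (.of_forall fun p => ?_)
    · rw [RCLike.norm_conj]; exact hM _
    · exact (hc.tendsto _).comp
        ((hθ.stronglyMeasurable.tendsto_approx p.1).const_sub p.2)
  have hsimple : ∀ k, ∀ Q : Measure (ℝ × ℝ), IsFiniteMeasure Q →
      ∫ p in Prod.fst ⁻¹' B, conj (h (unitExp (p.2 - a k p.1))) ∂Q =
        ∑ b ∈ (a k).range, ∫ p in Prod.fst ⁻¹' (B ∩ a k ⁻¹' {b}),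
          conj (h (unitExp p.2 * unitExp (-b))) ∂Q := by
    intro k Q _
    have hU : (Prod.fst ⁻¹' B : Set (ℝ × ℝ)) =
        ⋃ b ∈ (a k).range, Prod.fst ⁻¹' (B ∩ a k ⁻¹' {b}) := by
      ext p
      simp
    have hms : ∀ b, MeasurableSet (Prod.fst ⁻¹' (B ∩ a k ⁻¹' {b}) : Set (ℝ × ℝ)) := fun b =>
      measurable_fst (hB.inter ((a k).measurableSet_preimage _))
    rw [hU, integral_biUnion_finset _ (fun b _ => hms b)]
    · refine Finset.sum_congr rfl fun b _ => setIntegral_congr_fun (hms b) fun p hp => ?_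
      have : a k p.1 = b := hp.2
      simp only [this, unitExp_sub]
    · intro b _ b' _ hbb
      refine Set.disjoint_left.2 fun p hp hp' => hbb ?_
      exact hp.2.symm.trans hp'.2
    · intro b _
      refine Integrable.of_bound (C := M) (hm _ (a k).measurable).aestronglyMeasurable
        (.of_forall fun p => ?_)
      rw [RCLike.norm_conj]; exact hM _
  refine tendsto_nhds_unique (hlim P inferInstance) ?_
  have : ∀ k, ∫ p in Prod.fst ⁻¹' B, conj (h (unitExp (p.2 - a k p.1))) ∂P =
      ∫ p in Prod.fst ⁻¹' B, conj (h (unitExp (p.2 - a k p.1))) ∂N := by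
    intro k
    rw [hsimple k P inferInstance, hsimple k N inferInstance]
    refine Finset.sum_congr rfl fun b _ => ?_
    exact hPN.setIntegral_eq_of_measurableSet (hB.inter ((a k).measurableSet_preimage _))
      (measure_mono_null inter_subset_left h0) (inter_subset_left.trans hsub)
      (hh.mul_const_left (norm_unitExp _))
  simp only [this]
  exact hlim N inferInstance

/-- These polynomials peak at `1` and vanish at the origin. -/
lemma tendsto_mul_half_pow {z : ℂ} (hz : ‖z‖ = 1) :
    Tendsto (fun k : ℕ => z * ((1 + z) / 2) ^ k) atTop (𝓝 (if z = 1 then 1 else 0)) := by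
  split_ifs with h
  · simp [h]
  · have h1 : ‖(1 + z) / 2‖ < 1 := by
      rw [norm_div, Complex.norm_ofNat, div_lt_one two_pos]
      have hz2 : z.re * z.re + z.im * z.im = 1 := by
        rw [← Complex.normSq_apply, Complex.normSq_eq_norm_sq, hz, one_pow]
      have hre : z.re < 1 := by
        refine lt_of_le_of_ne (hz ▸ Complex.re_le_norm z) fun hre => h ?_
        refine Complex.ext (by simpa using hre) ?_
        rw [hre] at hz2
        have : z.im * z.im = 0 := by linarith
        simpa using this
      rw [← sq_lt_sq₀ (norm_nonneg _) zero_le_two, ← Complex.normSq_eq_norm_sq,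
        Complex.normSq_apply]
      simp
      nlinarith
    simpa using (tendsto_pow_atTop_nhds_zero_of_norm_lt_one h1).const_mul z

/-- After rotation by `θ` the graph becomes the circle point `1` in the second variable, which the
powers of `(1+z)/2` isolate. -/
lemma measure_graph_eq (hPN : IsRPPair P N) {B : Set ℝ} (hB : MeasurableSet B)
    (h0 : volume B = 0) (hsub : B ⊆ Ioo (-Real.pi) Real.pi) {θ : ℝ → ℝ} (hθ : Measurable θ) :
    P {p | p.1 ∈ B ∧ unitExp (p.2 - θ p.1) = 1} = N {p | p.1 ∈ B ∧ unitExp (p.2 - θ p.1) = 1} := by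
  have htest : ∀ k : ℕ, IsDiscTest fun z : ℂ => z * ((1 + z) / 2) ^ k := fun k =>
    ⟨⟨2, by norm_num, by fun_prop⟩, by simp⟩
  set D : Set (ℝ × ℝ) := {p | unitExp (p.2 - θ p.1) = 1} with hD
  have hmD : Measurable fun p : ℝ × ℝ => unitExp (p.2 - θ p.1) :=
    continuous_unitExp.measurable.comp (measurable_snd.sub (hθ.comp measurable_fst))
  have hDm : MeasurableSet D := hmD (measurableSet_singleton 1)
  have hBm : MeasurableSet (Prod.fst ⁻¹' B : Set (ℝ × ℝ)) := measurable_fst hB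
  have hlim : ∀ Q : Measure (ℝ × ℝ), IsFiniteMeasure Q →
      Tendsto (fun k : ℕ => ∫ p in Prod.fst ⁻¹' B, conj (unitExp (p.2 - θ p.1) *
        ((1 + unitExp (p.2 - θ p.1)) / 2) ^ k) ∂Q) atTop
        (𝓝 ((Q.real {p | p.1 ∈ B ∧ unitExp (p.2 - θ p.1) = 1} : ℝ) : ℂ)) := by
    intro Q _
    have e : ((Q.real {p | p.1 ∈ B ∧ unitExp (p.2 - θ p.1) = 1} : ℝ) : ℂ) =
        ∫ p in Prod.fst ⁻¹' B, D.indicator (fun _ => (1 : ℂ)) p ∂Q := by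
      rw [integral_indicator_const _ hDm, measureReal_restrict_apply hDm, Complex.real_smul,
        mul_one]
      congr 2
      ext p
      exact and_comm
    rw [e]
    refine tendsto_integral_of_dominated_convergence (fun _ => 1) (fun k => ?_)
      (integrable_const _) (fun k => .of_forall fun p => ?_) (.of_forall fun p => ?_)
    · exact (Complex.continuous_conj.measurable.comp
        (hmD.mul (((hmD.const_add 1).div_const 2).pow_const k))).aestronglyMeasurable
    · rw [RCLike.norm_conj, norm_mul, norm_unitExp, one_mul, norm_pow]
      refine pow_le_one₀ (norm_nonneg _) ?_
      rw [norm_div, Complex.norm_ofNat, div_le_one two_pos]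
      refine (norm_add_le _ _).trans ?_
      rw [norm_unitExp, norm_one]
      norm_num
    · have := (Complex.continuous_conj.tendsto _).comp
        (tendsto_mul_half_pow (norm_unitExp (p.2 - θ p.1)))
      have e' : D.indicator (fun _ => (1 : ℂ)) p =
          conj (if unitExp (p.2 - θ p.1) = 1 then 1 else 0) := by
        by_cases hp : unitExp (p.2 - θ p.1) = 1
        · rw [indicator_of_mem (by exact hp), if_pos hp, map_one]
        · rw [indicator_of_notMem (by exact hp), if_neg hp, map_zero]
      rw [e']
      exact this
  have h1 := hlim P inferInstance
  simp only [hPN.setIntegral_shift_eq hB h0 hsub (htest _) hθ] at h1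
  have h2 := tendsto_nhds_unique h1 (hlim N inferInstance)
  have h3 := Complex.ofReal_injective h2
  rwa [measureReal_def, measureReal_def, ENNReal.toReal_eq_toReal_iff'
    (measure_ne_top _ _) (measure_ne_top _ _)] at h3

/-- A measurable graph over a Lebesgue null set is negligible for the left member of a mutually
singular pair. -/
theorem measure_graph_eq_zero (hPN : IsRPPair P N) (hs : P ⟂ₘ N) {B : Set ℝ}
    (hB : MeasurableSet B) (h0 : volume B = 0) (hsub : B ⊆ Ico 0 1) {θ : ℝ → ℝ}
    (hθ : Measurable θ) (hθB : ∀ x ∈ B, θ x ∈ Ico 0 1) :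
    P {p | p.1 ∈ B ∧ p.2 = θ p.1} = 0 := by
  obtain ⟨s, hsm, hPs, hNs⟩ := hs
  have hpi := Real.pi_gt_three
  -- `P` is carried by `sᶜ`, which is `N`-null. Over `B'` the graph lies in `sᶜ`, so `N`, hence `P`,
  -- vanishes on it; the rest of the graph lies in the `P`-null set `s`.
  set B' : Set ℝ := B ∩ (fun x => (x, θ x)) ⁻¹' sᶜ with hB'
  have hB'm : MeasurableSet B' := hB.inter ((measurable_id.prodMk hθ) hsm.compl)
  have hN : N {p | p.1 ∈ B' ∧ unitExp (p.2 - θ p.1) = 1} = 0 := by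
    refine measure_mono_null (t := sᶜ ∪ {p : ℝ × ℝ | ¬ (p.1 ∈ Ioc (-Real.pi) Real.pi ∧
      p.2 ∈ Ioc (-Real.pi) Real.pi)}) ?_ (measure_union_null hNs hPN.mem_right)
    rintro p ⟨hp, he⟩
    by_cases hq : p.1 ∈ Ioc (-Real.pi) Real.pi ∧ p.2 ∈ Ioc (-Real.pi) Real.pi
    · left
      have h1 := hθB p.1 hp.1
      have : p.2 = θ p.1 := sub_eq_zero.1 ((unitExp_eq_one_iff (by
        rw [abs_lt]; constructor <;> linarith [hq.2.1, hq.2.2, h1.1, h1.2])).1 he)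
      have h2 : (p.1, θ p.1) ∈ sᶜ := hp.2
      rwa [← this] at h2
    · exact Or.inr hq
  rw [← hPN.measure_graph_eq hB'm (measure_mono_null inter_subset_left h0)
    (inter_subset_left.trans fun x hx => ?_) hθ] at hN
  · refine measure_mono_null (t := s ∪ {p | p.1 ∈ B' ∧ unitExp (p.2 - θ p.1) = 1}) ?_
      (measure_union_null hPs hN)
    rintro p ⟨hp, he⟩
    by_cases hps : p ∈ s
    · exact Or.inl hps
    · refine Or.inr ⟨⟨hp, ?_⟩, by simp [he, unitExp]⟩
      change (p.1, θ p.1) ∉ s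
      rwa [← he]
  · have := hsub hx
    constructor <;> linarith [this.1, this.2]

end IsRPPair

/-! ### Estimates for the Szegő kernel. -/

/-- The normalised Szegő kernel at distance `d` from the unit circle. -/
noncomputable def szegoKernel (d t : ℝ) : ℂ := d / (1 - (1 - d) * unitExp t)

/-- The normalised Szegő kernel with its constant term removed, as a holomorphic function. -/
noncomputable def szegoTest (d : ℝ) (z : ℂ) : ℂ := d * (1 - d) * z / (1 - (1 - d) * z)

section Kernel

variable {d : ℝ}

lemma le_norm_one_sub_mul_unitExp (h1 : d < 1) (t : ℝ) : d ≤ ‖1 - (1 - d) * unitExp t‖ := by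
  have := one_sub_le_norm_sub (a := 1) norm_one (norm_unitExp t) (r := 1 - d) (by linarith)
  push_cast at this
  linarith

lemma one_sub_mul_unitExp_ne_zero (h0 : 0 < d) (h1 : d < 1) (t : ℝ) :
    1 - (1 - d) * unitExp t ≠ 0 := by
  rw [← norm_pos_iff]
  exact h0.trans_le (le_norm_one_sub_mul_unitExp h1 t)

lemma continuous_szegoKernel (h0 : 0 < d) (h1 : d < 1) : Continuous (szegoKernel d) := by
  unfold szegoKernel
  exact Continuous.div (by fun_prop) (by fun_prop) (one_sub_mul_unitExp_ne_zero h0 h1)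

lemma norm_szegoKernel (h0 : 0 < d) (t : ℝ) :
    ‖szegoKernel d t‖ = d / ‖1 - (1 - d) * unitExp t‖ := by
  rw [szegoKernel, norm_div, Complex.norm_real, Real.norm_of_nonneg h0.le]

lemma norm_szegoKernel_le_one (h0 : 0 < d) (h1 : d < 1) (t : ℝ) : ‖szegoKernel d t‖ ≤ 1 := by
  rw [norm_szegoKernel h0]
  exact div_le_one_of_le₀ (le_norm_one_sub_mul_unitExp h1 t) (norm_nonneg _)

lemma szegoTest_unitExp (h0 : 0 < d) (h1 : d < 1) (t : ℝ) :
    szegoTest d (unitExp t) = szegoKernel d t - d := by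
  have := one_sub_mul_unitExp_ne_zero h0 h1 t
  rw [szegoTest, szegoKernel]
  field_simp
  ring

lemma norm_szegoTest_le (h0 : 0 < d) (h1 : d < 1) (t : ℝ) :
    ‖szegoTest d (unitExp t)‖ ≤ ‖szegoKernel d t‖ := by
  rw [szegoTest, szegoKernel, norm_div, norm_div, norm_mul, norm_mul, norm_unitExp, mul_one]
  gcongr
  have : ‖(1 : ℂ) - d‖ ≤ 1 := by
    rw [← Complex.ofReal_one, ← Complex.ofReal_sub, Complex.norm_real,
      Real.norm_of_nonneg (by linarith)]
    linarith
  exact mul_le_of_le_one_right (norm_nonneg _) this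

lemma isDiscTest_szegoTest (h0 : 0 < d) (h1 : d < 1) : IsDiscTest (szegoTest d) := by
  have hr : 0 < 1 - d := by linarith
  refine ⟨⟨(1 - d)⁻¹, (one_lt_inv₀ hr).2 (by linarith), ?_⟩, by simp [szegoTest]⟩
  unfold szegoTest
  refine DifferentiableOn.div (by fun_prop) (by fun_prop) fun z hz h => ?_
  rw [mem_ball_zero_iff] at hz
  have h2 : ‖(1 - d : ℂ) * z‖ = 1 := by rw [← sub_eq_zero.1 h, norm_one]
  rw [norm_mul, ← Complex.ofReal_one, ← Complex.ofReal_sub, Complex.norm_real,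
    Real.norm_of_nonneg hr.le] at h2
  have : (1 - d) * ‖z‖ < (1 - d) * (1 - d)⁻¹ := by gcongr
  rw [mul_inv_cancel₀ hr.ne'] at this
  linarith

lemma norm_one_sub_mul_unitExp_le (h0 : 0 < d) (t : ℝ) :
    ‖1 - (1 - d) * unitExp t‖ ≤ d + |t| := by
  have e : 1 - (1 - d) * unitExp t = (1 - unitExp t) + d * unitExp t := by ring
  rw [e]
  refine (norm_add_le _ _).trans ?_
  rw [norm_real_mul_unitExp h0.le, add_comm]
  gcongr
  exact norm_one_sub_unitExp_le t

lemma norm_one_sub_unitExp_le_two_mul (h0 : 0 < d) (h1 : d < 1) (t : ℝ) :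
    ‖1 - unitExp t‖ ≤ 2 * ‖1 - (1 - d) * unitExp t‖ := by
  have e : 1 - unitExp t = (1 - (1 - d) * unitExp t) - d * unitExp t := by ring
  rw [e]
  refine (norm_sub_le _ _).trans ?_
  rw [norm_real_mul_unitExp h0.le]
  have := le_norm_one_sub_mul_unitExp h1 t
  linarith

lemma norm_szegoKernel_le_div (h0 : 0 < d) (h1 : d < 1) {t η : ℝ} (hη : 0 < η)
    (h : η ≤ ‖1 - unitExp t‖) : ‖szegoKernel d t‖ ≤ 2 * d / η := by
  have h2 := norm_one_sub_unitExp_le_two_mul h0 h1 t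
  rw [norm_szegoKernel h0, div_le_div_iff₀ (h0.trans_le (le_norm_one_sub_mul_unitExp h1 t)) hη]
  nlinarith

/-- The square is at most `d` times the Poisson kernel of radius `1 - d`, since `d ≤ 1 - (1-d)²`;
that kernel has integral `2π` over a period. -/
lemma integral_norm_szegoKernel_sq_le (h0 : 0 < d) (h1 : d < 1) (y : ℝ) {A : Set ℝ}
    (hA : A ⊆ Icc 0 1) : ∫ s in A, ‖szegoKernel d (y - s)‖ ^ 2 ≤ 2 * Real.pi * d := by
  have hr : 0 ≤ 1 - d := by linarith
  have hw : ‖((1 - d : ℝ) : ℂ) * unitExp y‖ = 1 - d := norm_real_mul_unitExp hr y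
  have hp := integral_poisson_mul (g := fun _ => 1) (R := 2) (by norm_num)
    (differentiableOn_const _) (w := ((1 - d : ℝ) : ℂ) * unitExp y) (by rw [hw]; linarith)
  simp only [mul_one, hw] at hp
  rw [integral_complex_ofReal] at hp
  have hp' : ∫ a, (1 - (1 - d) ^ 2) / ‖unitExp a - ((1 - d : ℝ) : ℂ) * unitExp y‖ ^ 2
      ∂periodMeasure = 2 * Real.pi := by exact_mod_cast hp
  have hnorm : ∀ a, ‖unitExp a - ((1 - d : ℝ) : ℂ) * unitExp y‖ =
      ‖1 - (1 - d) * unitExp (y - a)‖ := fun a => by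
    have e : unitExp a - ((1 - d : ℝ) : ℂ) * unitExp y =
        unitExp a * (1 - (1 - d) * unitExp (y - a)) := by
      have : unitExp a * unitExp (y - a) = unitExp y := by rw [← unitExp_add]; ring_nf
      push_cast
      linear_combination (1 - d : ℂ) * this
    rw [e, norm_mul, norm_unitExp, one_mul]
  have hcont : Continuous fun s => ‖szegoKernel d (y - s)‖ ^ 2 :=
    (((continuous_szegoKernel h0 h1).comp (by fun_prop)).norm).pow 2
  have hpi := Real.pi_gt_three
  have hsub : A ≤ᵐ[volume] Ioc 0 (2 * Real.pi) := by
    have : (Ioc 0 1 : Set ℝ) ⊆ Ioc 0 (2 * Real.pi) := Ioc_subset_Ioc_right (by linarith)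
    exact (LE.le.eventuallyLE hA).trans
      (Ioc_ae_eq_Icc.symm.le.trans this.eventuallyLE)
  calc ∫ s in A, ‖szegoKernel d (y - s)‖ ^ 2
      ≤ ∫ s, ‖szegoKernel d (y - s)‖ ^ 2 ∂periodMeasure :=
        setIntegral_mono_set ((hcont.continuousOn.integrableOn_compact isCompact_Icc).mono_set
          Ioc_subset_Icc_self) (.of_forall fun s => by positivity) hsub
    _ ≤ ∫ a, d * ((1 - (1 - d) ^ 2) / ‖unitExp a - ((1 - d : ℝ) : ℂ) * unitExp y‖ ^ 2)
          ∂periodMeasure := by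
        refine integral_mono_of_nonneg (.of_forall fun s => by positivity) ?_
          (.of_forall fun a => ?_)
        · refine Integrable.const_mul ?_ _
          refine Integrable.of_integral_ne_zero ?_
          rw [hp']
          positivity
        · simp only
          rw [hnorm, norm_szegoKernel h0, div_pow, mul_div_assoc']
          gcongr
          nlinarith
    _ = 2 * Real.pi * d := by rw [integral_const_mul, hp']; ring

/-- With denominators `a`, `b`, the real part is `d² (Re a Re b + Im a Im b) / (|a|² |b|²)`. Both
real parts are at least `d`, and the imaginary parts have a nonnegative product because `s` and `t`
do not have opposite signs. This is what monotonicity of `ψ` is needed for. -/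
lemma le_re_szegoKernel_mul_conj (h0 : 0 < d) (h1 : d < 1) {s t : ℝ}
    (hst : 0 ≤ s * t) (hs : |s| ≤ 1) (ht : |t| ≤ 1) :
    d ^ 4 / ((d + |s|) ^ 2 * (d + |t|) ^ 2) ≤ (szegoKernel d s * conj (szegoKernel d t)).re := by
  set a : ℂ := 1 - (1 - d) * unitExp s with ha
  set b : ℂ := 1 - (1 - d) * unitExp t with hb
  have ha0 : 0 < ‖a‖ := h0.trans_le (le_norm_one_sub_mul_unitExp h1 s)
  have hb0 : 0 < ‖b‖ := h0.trans_le (le_norm_one_sub_mul_unitExp h1 t)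
  have hle : ‖a‖ ^ 2 * ‖b‖ ^ 2 ≤ (d + |s|) ^ 2 * (d + |t|) ^ 2 := by
    gcongr
    · exact norm_one_sub_mul_unitExp_le h0 s
    · exact norm_one_sub_mul_unitExp_le h0 t
  have e : (szegoKernel d s * conj (szegoKernel d t)).re =
      d ^ 2 * (a.re * b.re + a.im * b.im) / (‖a‖ ^ 2 * ‖b‖ ^ 2) := by
    have e1 : szegoKernel d s * conj (szegoKernel d t) =
        ((d ^ 2 : ℝ) : ℂ) * (a * conj b)⁻¹ * (a * conj b * conj (a * conj b)) /
          ((‖a‖ ^ 2 * ‖b‖ ^ 2 : ℝ) : ℂ) := by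
      have han : a ≠ 0 := norm_pos_iff.1 ha0
      have hbn : conj b ≠ 0 := by simpa using norm_pos_iff.1 hb0
      have h2 : a * conj b * conj (a * conj b) = ((‖a‖ ^ 2 * ‖b‖ ^ 2 : ℝ) : ℂ) := by
        rw [Complex.mul_conj, Complex.normSq_eq_norm_sq, norm_mul, RCLike.norm_conj, mul_pow]
      have h3 : ((‖a‖ ^ 2 * ‖b‖ ^ 2 : ℝ) : ℂ) ≠ 0 := by
        exact_mod_cast (by positivity : ‖a‖ ^ 2 * ‖b‖ ^ 2 ≠ 0)
      rw [h2, mul_div_assoc, div_self h3, mul_one, szegoKernel, szegoKernel, map_div₀,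
        Complex.conj_ofReal, ← ha, ← hb]
      push_cast
      field_simp
    have han : a ≠ 0 := norm_pos_iff.1 ha0
    have hbn : conj b ≠ 0 := by simpa using norm_pos_iff.1 hb0
    rw [e1, mul_assoc, inv_mul_cancel_left₀ (mul_ne_zero han hbn), mul_div_assoc,
      Complex.re_ofReal_mul, Complex.div_ofReal_re, map_mul, Complex.conj_conj,
      Complex.mul_re, Complex.conj_re, Complex.conj_im]
    ring
  have hsin : 0 ≤ Real.sin s * Real.sin t := by
    have hpi := Real.pi_gt_three
    rw [abs_le] at hs ht
    rcases le_total 0 s with h | h <;> rcases le_total 0 t with h' | h'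
    · exact mul_nonneg (Real.sin_nonneg_of_nonneg_of_le_pi h (by linarith))
        (Real.sin_nonneg_of_nonneg_of_le_pi h' (by linarith))
    · have : s * t = 0 := le_antisymm (mul_nonpos_of_nonneg_of_nonpos h h') hst
      rcases mul_eq_zero.1 this with h | h <;> simp [h]
    · have : s * t = 0 := le_antisymm (mul_nonpos_of_nonpos_of_nonneg h h') hst
      rcases mul_eq_zero.1 this with h | h <;> simp [h]
    · exact mul_nonneg_of_nonpos_of_nonpos
        (Real.sin_nonpos_of_nonpos_of_neg_pi_le h (by linarith))
        (Real.sin_nonpos_of_nonpos_of_neg_pi_le h' (by linarith))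
  have hre : ∀ t, (1 - (1 - d) * unitExp t).re = 1 - (1 - d) * Real.cos t := fun t => by
    simp [unitExp_re]
  have him : ∀ t, (1 - (1 - d) * unitExp t).im = -((1 - d) * Real.sin t) := fun t => by
    simp [unitExp_im]
  have hnum : d ^ 2 ≤ a.re * b.re + a.im * b.im := by
    rw [ha, hb, hre, hre, him, him]
    have h2 : d ≤ 1 - (1 - d) * Real.cos s := by nlinarith [Real.cos_le_one s]
    have h3 : d ≤ 1 - (1 - d) * Real.cos t := by nlinarith [Real.cos_le_one t]
    have h4 : d * d ≤ (1 - (1 - d) * Real.cos s) * (1 - (1 - d) * Real.cos t) :=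
      mul_le_mul h2 h3 h0.le (h0.le.trans h2)
    have h5 : 0 ≤ (1 - d) ^ 2 * (Real.sin s * Real.sin t) := by positivity
    nlinarith
  rw [e]
  refine div_le_div₀ (by nlinarith [sq_nonneg d]) ?_ (by positivity) hle
  have : d ^ 4 = d ^ 2 * d ^ 2 := by ring
  rw [this]
  gcongr

end Kernel

/-! ### The kernel concentrated on an increasing curve. -/

/-- The superposition, along the graph of `ψ` over `S`, of products of Szegő kernels. -/
noncomputable def curveKernel (ψ : ℝ → ℝ) (S : Set ℝ) (d : ℝ) (p : ℝ × ℝ) : ℂ :=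
  (d : ℂ)⁻¹ *
    ∫ s in S, szegoTest d (unitExp (p.1 - s)) * conj (szegoTest d (unitExp (p.2 - ψ s)))

/-- The error made in `curveKernel` by dropping the constant terms of the Szegő kernels. -/
noncomputable def curveError (ψ : ℝ → ℝ) (S : Set ℝ) (d : ℝ) (p : ℝ × ℝ) : ℝ :=
  ∫ s in S, (‖szegoKernel d (p.1 - s)‖ + ‖szegoKernel d (p.2 - ψ s)‖)

section Curve

variable {ψ : ℝ → ℝ} {S : Set ℝ} {d : ℝ}

lemma continuous_szegoTest_unitExp (h0 : 0 < d) (h1 : d < 1) :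
    Continuous fun t => szegoTest d (unitExp t) :=
  (isDiscTest_szegoTest h0 h1).continuous_unitExp

lemma norm_szegoTest_mul_conj_le (h0 : 0 < d) (h1 : d < 1) (a b : ℝ) :
    ‖szegoTest d (unitExp a) * conj (szegoTest d (unitExp b))‖ ≤
      ‖szegoKernel d a‖ * ‖szegoKernel d b‖ := by
  rw [norm_mul, RCLike.norm_conj]
  exact mul_le_mul (norm_szegoTest_le h0 h1 _) (norm_szegoTest_le h0 h1 _) (norm_nonneg _)
    (norm_nonneg _)

lemma measurable_szegoTest_mul_conj (hψ : Measurable ψ) (h0 : 0 < d) (h1 : d < 1) :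
    Measurable fun x : (ℝ × ℝ) × ℝ => szegoTest d (unitExp (x.1.1 - x.2)) *
      conj (szegoTest d (unitExp (x.1.2 - ψ x.2))) := by
  have hc := (continuous_szegoTest_unitExp h0 h1).measurable
  have e1 : Measurable fun x : (ℝ × ℝ) × ℝ => x.1.1 - x.2 := by fun_prop
  have e2 : Measurable fun x : (ℝ × ℝ) × ℝ => x.1.2 - ψ x.2 := by fun_prop
  exact (hc.comp e1).mul (Complex.continuous_conj.measurable.comp (hc.comp e2))

lemma measurable_curveKernel (hψ : Measurable ψ) (h0 : 0 < d) (h1 : d < 1) :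
    Measurable (curveKernel ψ S d) :=
  (((measurable_szegoTest_mul_conj hψ h0 h1).stronglyMeasurable.integral_prod_right
    (ν := volume.restrict S)).measurable).const_mul _

lemma measurable_curveError (hψ : Measurable ψ) (h0 : 0 < d) (h1 : d < 1) :
    Measurable (curveError ψ S d) := by
  have hc := (continuous_szegoKernel h0 h1).norm.measurable
  have e1 : Measurable fun x : (ℝ × ℝ) × ℝ => x.1.1 - x.2 := by fun_prop
  have e2 : Measurable fun x : (ℝ × ℝ) × ℝ => x.1.2 - ψ x.2 := by fun_prop
  exact (((hc.comp e1).add (hc.comp e2)).stronglyMeasurable.integral_prod_right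
    (ν := volume.restrict S)).measurable

lemma integrableOn_of_norm_le_one {E : Type*} [NormedAddCommGroup E] (hS : volume S ≠ ⊤)
    {f : ℝ → E} (hf : AEStronglyMeasurable f) (h : ∀ s, ‖f s‖ ≤ 1) : IntegrableOn f S := by
  have : IsFiniteMeasure (volume.restrict S) := ⟨by simpa using hS.lt_top⟩
  exact Integrable.of_bound hf.restrict 1 (.of_forall h)

lemma integrableOn_szegoTest_mul_conj (hψ : Measurable ψ) (hS : volume S ≠ ⊤) (h0 : 0 < d)
    (h1 : d < 1) (p : ℝ × ℝ) : IntegrableOn (fun s => szegoTest d (unitExp (p.1 - s)) *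
      conj (szegoTest d (unitExp (p.2 - ψ s)))) S := by
  refine integrableOn_of_norm_le_one hS ((measurable_szegoTest_mul_conj hψ h0 h1).comp
    (by fun_prop : Measurable fun s : ℝ => (p, s))).aestronglyMeasurable fun s => ?_
  exact (norm_szegoTest_mul_conj_le h0 h1 _ _).trans (mul_le_one₀
    (norm_szegoKernel_le_one h0 h1 _) (norm_nonneg _) (norm_szegoKernel_le_one h0 h1 _))

lemma integrableOn_norm_szegoKernel (hS : volume S ≠ ⊤) (h0 : 0 < d) (h1 : d < 1)
    {φ : ℝ → ℝ} (hφ : Measurable φ) : IntegrableOn (fun s => ‖szegoKernel d (φ s)‖) S :=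
  integrableOn_of_norm_le_one hS
    ((continuous_szegoKernel h0 h1).norm.measurable.comp hφ).aestronglyMeasurable fun s => by
      rw [norm_norm]; exact norm_szegoKernel_le_one h0 h1 _

lemma integrableOn_norm_szegoKernel_sq (hS : volume S ≠ ⊤) (h0 : 0 < d) (h1 : d < 1)
    {φ : ℝ → ℝ} (hφ : Measurable φ) : IntegrableOn (fun s => ‖szegoKernel d (φ s)‖ ^ 2) S :=
  integrableOn_of_norm_le_one hS
    (((continuous_szegoKernel h0 h1).norm.pow 2).measurable.comp hφ).aestronglyMeasurable
    fun s => by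
      rw [norm_pow, norm_norm]
      exact pow_le_one₀ (norm_nonneg _) (norm_szegoKernel_le_one h0 h1 _)

/-- By Fubini: for fixed `s` the integrand is a product of two rotated test functions. -/
lemma IsRPPair.integral_curveKernel_eq {P N : Measure (ℝ × ℝ)} [IsFiniteMeasure P]
    [IsFiniteMeasure N] (hPN : IsRPPair P N) (hψ : Measurable ψ) (hS : volume S ≠ ⊤) (h0 : 0 < d)
    (h1 : d < 1) : ∫ p, curveKernel ψ S d p ∂P = ∫ p, curveKernel ψ S d p ∂N := by
  have : IsFiniteMeasure (volume.restrict S) := ⟨by simpa using hS.lt_top⟩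
  have key : ∀ Q : Measure (ℝ × ℝ), IsFiniteMeasure Q → ∫ p, curveKernel ψ S d p ∂Q =
      (d : ℂ)⁻¹ * ∫ s in S, ∫ p : ℝ × ℝ, szegoTest d (unitExp (p.1 - s)) *
        conj (szegoTest d (unitExp (p.2 - ψ s))) ∂Q := by
    intro Q _
    simp only [curveKernel]
    rw [integral_const_mul, integral_integral_swap]
    refine Integrable.of_bound (measurable_szegoTest_mul_conj hψ h0 h1).aestronglyMeasurable 1
      (.of_forall fun x => ?_)
    exact (norm_szegoTest_mul_conj_le h0 h1 _ _).trans (mul_le_one₀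
      (norm_szegoKernel_le_one h0 h1 _) (norm_nonneg _) (norm_szegoKernel_le_one h0 h1 _))
  rw [key P inferInstance, key N inferInstance]
  congr 2
  funext s
  have ht := isDiscTest_szegoTest h0 h1
  have := hPN.integral_eq _ _ (ht.mul_const_left (norm_unitExp (-s)))
    (ht.mul_const_left (norm_unitExp (-ψ s)))
  simpa only [← unitExp_sub] using this

lemma tendsto_norm_szegoKernel_zero {δ : ℕ → ℝ} (h0 : ∀ m, 0 < δ m) (h1 : ∀ m, δ m < 1)
    (hδ : Tendsto δ atTop (𝓝 0)) {t : ℝ} (ht : unitExp t ≠ 1) :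
    Tendsto (fun m => ‖szegoKernel (δ m) t‖) atTop (𝓝 0) := by
  have hη : 0 < ‖1 - unitExp t‖ := norm_pos_iff.2 (sub_ne_zero.2 ht.symm)
  refine squeeze_zero (fun _ => norm_nonneg _)
    (fun m => norm_szegoKernel_le_div (h0 m) (h1 m) hη le_rfl) ?_
  simpa using (hδ.const_mul 2).div_const ‖1 - unitExp t‖

/-- The hypotheses under which the curve kernel is used: `ψ` is strictly increasing, and its
derivative is bounded below on the compact set `S`. -/
structure IsSteepOn (ψ : ℝ → ℝ) (S : Set ℝ) (n : ℝ) : Prop where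
  strictMono : StrictMono ψ
  isCompact : IsCompact S
  subset : S ⊆ Ico 0 1
  mapsTo : ∀ x ∈ S, ψ x ∈ Ico 0 1
  differentiableAt : ∀ x ∈ S, DifferentiableAt ℝ ψ x
  one_le : ∀ x ∈ S, 1 ≤ n * deriv ψ x

namespace IsSteepOn

variable {n : ℝ} (hS : IsSteepOn ψ S n)
include hS

lemma measurable : Measurable ψ := hS.strictMono.monotone.measurable

lemma volume_ne_top : volume S ≠ ⊤ := hS.isCompact.measure_lt_top.ne

/-- Change of variables `t = ψ s`, after inserting the factor `n ψ' ≥ 1`. -/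
lemma integral_norm_szegoKernel_sq_comp_le (hn : 0 ≤ n) (h0 : 0 < d) (h1 : d < 1) (y : ℝ) :
    ∫ s in S, ‖szegoKernel d (y - ψ s)‖ ^ 2 ≤ n * (2 * Real.pi * d) := by
  have hder : ∀ x ∈ S, HasDerivWithinAt ψ (deriv ψ x) S x := fun x hx =>
    (hS.differentiableAt x hx).hasDerivAt.hasDerivWithinAt
  have hcont : Continuous fun t => ‖szegoKernel d (y - t)‖ ^ 2 :=
    (((continuous_szegoKernel h0 h1).comp (by fun_prop)).norm).pow 2
  have himg : ψ '' S ⊆ Icc 0 1 := by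
    rintro _ ⟨x, hx, rfl⟩
    exact Ico_subset_Icc_self (hS.mapsTo x hx)
  have hcov := integral_image_eq_integral_abs_deriv_smul hS.isCompact.measurableSet hder
    hS.strictMono.injective.injOn fun t => ‖szegoKernel d (y - t)‖ ^ 2
  have hint := (integrableOn_image_iff_integrableOn_abs_deriv_smul hS.isCompact.measurableSet hder
    hS.strictMono.injective.injOn fun t => ‖szegoKernel d (y - t)‖ ^ 2).1
    ((hcont.continuousOn.integrableOn_compact isCompact_Icc).mono_set himg)
  have hle := integral_norm_szegoKernel_sq_le h0 h1 y himg
  calc ∫ s in S, ‖szegoKernel d (y - ψ s)‖ ^ 2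
      ≤ ∫ s in S, n * (|deriv ψ s| • ‖szegoKernel d (y - ψ s)‖ ^ 2) := by
        refine setIntegral_mono_on (integrableOn_norm_szegoKernel_sq hS.volume_ne_top h0 h1
          (hS.measurable.const_sub y)) (hint.const_mul n) hS.isCompact.measurableSet fun s hs => ?_
        have h2 := hS.one_le s hs
        have h3 : 1 ≤ n * |deriv ψ s| := h2.trans (mul_le_mul_of_nonneg_left (le_abs_self _) hn)
        rw [smul_eq_mul, ← mul_assoc]
        exact le_mul_of_one_le_left (by positivity) h3
    _ ≤ n * (2 * Real.pi * d) := by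
        rw [integral_const_mul, ← hcov]
        exact mul_le_mul_of_nonneg_left hle hn

/-- The product of the two kernels is at most the sum of their squares, whose integrals are `O(d)`;
this compensates the factor `1/d`. -/
lemma norm_curveKernel_le (hn : 0 ≤ n) (h0 : 0 < d) (h1 : d < 1) (p : ℝ × ℝ) :
    ‖curveKernel ψ S d p‖ ≤ 2 * Real.pi * (1 + n) := by
  have hm1 : Measurable fun s : ℝ => p.1 - s := by fun_prop
  have hm2 := hS.measurable.const_sub p.2
  have i1 := integrableOn_norm_szegoKernel_sq hS.volume_ne_top h0 h1 hm1
  have i2 := integrableOn_norm_szegoKernel_sq hS.volume_ne_top h0 h1 hm2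
  have h2 := integral_norm_szegoKernel_sq_le h0 h1 p.1 (hS.subset.trans Ico_subset_Icc_self)
  have h3 := hS.integral_norm_szegoKernel_sq_comp_le hn h0 h1 p.2
  rw [curveKernel, norm_mul, norm_inv, Complex.norm_real, Real.norm_of_nonneg h0.le,
    inv_mul_le_iff₀ h0]
  calc _ ≤ ∫ s in S, (‖szegoKernel d (p.1 - s)‖ ^ 2 + ‖szegoKernel d (p.2 - ψ s)‖ ^ 2) := by
        refine norm_integral_le_of_norm_le (i1.add i2) (.of_forall fun s => ?_)
        refine (norm_szegoTest_mul_conj_le h0 h1 _ _).trans ?_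
        nlinarith [sq_nonneg (‖szegoKernel d (p.1 - s)‖ - ‖szegoKernel d (p.2 - ψ s)‖),
          sq_nonneg ‖szegoKernel d (p.1 - s)‖, sq_nonneg ‖szegoKernel d (p.2 - ψ s)‖]
    _ ≤ 2 * Real.pi * d + n * (2 * Real.pi * d) := by
        rw [integral_add i1 i2]
        exact add_le_add h2 h3
    _ = _ := by ring

lemma abs_curveError_le (h0 : 0 < d) (h1 : d < 1) (p : ℝ × ℝ) : |curveError ψ S d p| ≤ 2 := by
  have hv : volume.real S ≤ 1 := by
    have := measureReal_mono (μ := volume) hS.subset measure_Ico_lt_top.ne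
    simpa using this
  have := norm_setIntegral_le_of_norm_le_const (μ := volume) (s := S) (C := 2)
    hS.isCompact.measure_lt_top
    (f := fun s => ‖szegoKernel d (p.1 - s)‖ + ‖szegoKernel d (p.2 - ψ s)‖) fun s _ => by
      rw [Real.norm_of_nonneg (by positivity)]
      linarith [norm_szegoKernel_le_one h0 h1 (p.1 - s), norm_szegoKernel_le_one h0 h1 (p.2 - ψ s)]
  rw [← Real.norm_eq_abs, curveError]
  linarith

lemma ae_unitExp_ne_one {p : ℝ × ℝ}
    (hp : p.1 ∈ Ioc (-Real.pi) Real.pi ∧ p.2 ∈ Ioc (-Real.pi) Real.pi) :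
    ∀ᵐ s ∂volume.restrict S, unitExp (p.1 - s) ≠ 1 ∧ unitExp (p.2 - ψ s) ≠ 1 := by
  have hpi := Real.pi_gt_three
  have n1 : volume {p.1} = 0 := by simp
  have n2 : volume (ψ ⁻¹' {p.2}) = 0 :=
    (Set.subsingleton_singleton.preimage hS.strictMono.injective).measure_zero _
  rw [ae_restrict_iff' hS.isCompact.measurableSet]
  filter_upwards [measure_eq_zero_iff_ae_notMem.1 n1, measure_eq_zero_iff_ae_notMem.1 n2]
    with s hs1 hs2 hs
  have b1 := hS.subset hs
  have b2 := hS.mapsTo s hs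
  refine ⟨fun h => hs1 ?_, fun h => hs2 ?_⟩
  · have := (unitExp_eq_one_iff (by
      rw [abs_lt]; constructor <;> linarith [hp.1.1, hp.1.2, b1.1, b1.2])).1 h
    exact (sub_eq_zero.1 this).symm
  · have := (unitExp_eq_one_iff (by
      rw [abs_lt]; constructor <;> linarith [hp.2.1, hp.2.2, b2.1, b2.2])).1 h
    exact (sub_eq_zero.1 this).symm

lemma tendsto_curveError {δ : ℕ → ℝ} (h0 : ∀ m, 0 < δ m) (h1 : ∀ m, δ m < 1)
    (hδ : Tendsto δ atTop (𝓝 0)) {p : ℝ × ℝ}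
    (hp : p.1 ∈ Ioc (-Real.pi) Real.pi ∧ p.2 ∈ Ioc (-Real.pi) Real.pi) :
    Tendsto (fun m => curveError ψ S (δ m) p) atTop (𝓝 0) := by
  have hm1 : Measurable fun s : ℝ => p.1 - s := by fun_prop
  have hm2 := hS.measurable.const_sub p.2
  have : IsFiniteMeasure (volume.restrict S) := ⟨by simpa using hS.volume_ne_top.lt_top⟩
  have := tendsto_integral_of_dominated_convergence (μ := volume.restrict S)
    (F := fun m s => ‖szegoKernel (δ m) (p.1 - s)‖ + ‖szegoKernel (δ m) (p.2 - ψ s)‖)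
    (f := fun _ => 0) (fun _ => 2)
    (fun m => ((integrableOn_norm_szegoKernel hS.volume_ne_top (h0 m) (h1 m) hm1).add
      (integrableOn_norm_szegoKernel hS.volume_ne_top (h0 m) (h1 m) hm2)).aestronglyMeasurable)
    (integrable_const _) (fun m => .of_forall fun s => by
      rw [Real.norm_of_nonneg (by positivity)]
      linarith [norm_szegoKernel_le_one (h0 m) (h1 m) (p.1 - s),
        norm_szegoKernel_le_one (h0 m) (h1 m) (p.2 - ψ s)]) (by
      filter_upwards [hS.ae_unitExp_ne_one hp] with s hs
      simpa using (tendsto_norm_szegoKernel_zero h0 h1 hδ hs.1).add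
        (tendsto_norm_szegoKernel_zero h0 h1 hδ hs.2))
  simpa [curveError] using this

/-- `ψ` is continuous at the points of the compact set `S`, so the distance to the curve is
attained; it is zero only on the graph. -/
lemma exists_le_norm_add_norm {p : ℝ × ℝ}
    (hp : p.1 ∈ Ioc (-Real.pi) Real.pi ∧ p.2 ∈ Ioc (-Real.pi) Real.pi)
    (hpS : ¬ (p.1 ∈ S ∧ p.2 = ψ p.1)) :
    ∃ η > 0, ∀ s ∈ S, η ≤ ‖1 - unitExp (p.1 - s)‖ + ‖1 - unitExp (p.2 - ψ s)‖ := by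
  rcases S.eq_empty_or_nonempty with rfl | hne
  · exact ⟨1, one_pos, by simp⟩
  have hcψ : ContinuousOn ψ S := fun x hx =>
    (hS.differentiableAt x hx).continuousAt.continuousWithinAt
  have hc : ContinuousOn (fun s => ‖1 - unitExp (p.1 - s)‖ + ‖1 - unitExp (p.2 - ψ s)‖) S := by
    refine ContinuousOn.add (by fun_prop) (ContinuousOn.norm (continuousOn_const.sub ?_))
    exact continuous_unitExp.comp_continuousOn (continuousOn_const.sub hcψ)
  obtain ⟨s, hs, hmin⟩ := hS.isCompact.exists_isMinOn hne hc
  refine ⟨_, lt_of_le_of_ne (by positivity) fun h => hpS ?_, fun t ht => hmin ht⟩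
  have h1 : ‖1 - unitExp (p.1 - s)‖ = 0 := by
    linarith [norm_nonneg (1 - unitExp (p.1 - s)), norm_nonneg (1 - unitExp (p.2 - ψ s))]
  have h2 : ‖1 - unitExp (p.2 - ψ s)‖ = 0 := by
    linarith [norm_nonneg (1 - unitExp (p.1 - s)), norm_nonneg (1 - unitExp (p.2 - ψ s))]
  rw [norm_eq_zero, sub_eq_zero] at h1 h2
  have hpi := Real.pi_gt_three
  have b1 := hS.subset hs
  have b2 := hS.mapsTo s hs
  have e1 := (unitExp_eq_one_iff (by
      rw [abs_lt]; constructor <;> linarith [hp.1.1, hp.1.2, b1.1, b1.2])).1 h1.symm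
  have e2 := (unitExp_eq_one_iff (by
      rw [abs_lt]; constructor <;> linarith [hp.2.1, hp.2.2, b2.1, b2.2])).1 h2.symm
  have e3 : p.1 = s := by linarith
  exact ⟨e3 ▸ hs, by rw [e3]; linarith⟩

lemma tendsto_curveKernel {δ : ℕ → ℝ} (h0 : ∀ m, 0 < δ m) (h1 : ∀ m, δ m < 1)
    (hδ : Tendsto δ atTop (𝓝 0)) {p : ℝ × ℝ}
    (hp : p.1 ∈ Ioc (-Real.pi) Real.pi ∧ p.2 ∈ Ioc (-Real.pi) Real.pi)
    (hpS : ¬ (p.1 ∈ S ∧ p.2 = ψ p.1)) :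
    Tendsto (fun m => curveKernel ψ S (δ m) p) atTop (𝓝 0) := by
  obtain ⟨η, hη, hle⟩ := hS.exists_le_norm_add_norm hp hpS
  have : IsFiniteMeasure (volume.restrict S) := ⟨by simpa using hS.volume_ne_top.lt_top⟩
  have := tendsto_integral_of_dominated_convergence (μ := volume.restrict S)
    (F := fun m s => ((δ m)⁻¹ : ℂ) * (szegoTest (δ m) (unitExp (p.1 - s)) *
      conj (szegoTest (δ m) (unitExp (p.2 - ψ s)))))
    (f := fun _ => 0) (fun _ => 4 / η)
    (fun m => ((integrableOn_szegoTest_mul_conj hS.measurable hS.volume_ne_top (h0 m) (h1 m)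
      p).const_mul _).aestronglyMeasurable)
    (integrable_const _) (fun m => by
      filter_upwards [ae_restrict_mem hS.isCompact.measurableSet] with s hs
      have hd := h0 m
      rw [norm_mul, norm_inv, Complex.norm_real, Real.norm_of_nonneg hd.le, inv_mul_le_iff₀ hd]
      refine (norm_szegoTest_mul_conj_le hd (h1 m) _ _).trans ?_
      -- For each `s` at least one coordinate is at distance `η / 2` or more, so the kernel in that
      -- coordinate is `O(d)` and cancels `1/d`.
      have e : δ m * (4 / η) = 2 * δ m / (η / 2) := by field_simp; norm_num
      rw [e]
      rcases le_or_gt (η / 2) ‖1 - unitExp (p.1 - s)‖ with h | h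
      · exact (mul_le_of_le_one_right (norm_nonneg _)
          (norm_szegoKernel_le_one hd (h1 m) _)).trans
          (norm_szegoKernel_le_div hd (h1 m) (by positivity) h)
      · exact (mul_le_of_le_one_left (norm_nonneg _)
          (norm_szegoKernel_le_one hd (h1 m) _)).trans
          (norm_szegoKernel_le_div hd (h1 m) (by positivity) (by linarith [hle s hs]))) (by
      filter_upwards [hS.ae_unitExp_ne_one hp] with s hs
      have hη1 : 0 < ‖1 - unitExp (p.1 - s)‖ := norm_pos_iff.2 (sub_ne_zero.2 hs.1.symm)
      refine squeeze_zero_norm (a := fun m => 2 / ‖1 - unitExp (p.1 - s)‖ *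
        ‖szegoKernel (δ m) (p.2 - ψ s)‖) (fun m => ?_) (by
          simpa using (tendsto_norm_szegoKernel_zero h0 h1 hδ hs.2).const_mul _)
      have hd := h0 m
      rw [norm_mul, norm_inv, Complex.norm_real, Real.norm_of_nonneg hd.le, inv_mul_le_iff₀ hd]
      refine (norm_szegoTest_mul_conj_le hd (h1 m) _ _).trans ?_
      rw [← mul_assoc]
      refine mul_le_mul_of_nonneg_right ?_ (norm_nonneg _)
      refine (norm_szegoKernel_le_div hd (h1 m) hη1 le_rfl).trans_eq ?_
      ring)
  simpa only [curveKernel, integral_const_mul, integral_zero] using this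

/-- At a point of the graph the main integrand is nonnegative by monotonicity, so the integral may
be cut down to `S ∩ T`. Leaving `T` free gives two uses: `T = ∅` yields nonnegativity, and a ball of
radius `d` yields the quantitative bound. -/
lemma re_curveKernel_add_curveError_ge (h0 : 0 < d) (h1 : d < 1) {x L : ℝ} (hx : x ∈ S)
    (hL : 0 ≤ L) {T : Set ℝ} (hTm : MeasurableSet T) (hT : T ⊆ closedBall x d)
    (hLip : ∀ s ∈ T, |ψ x - ψ s| ≤ L * |x - s|) :
    d⁻¹ * (volume.real (S ∩ T) * (4 * (1 + L) ^ 2)⁻¹) ≤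
      (curveKernel ψ S d (x, ψ x)).re + curveError ψ S d (x, ψ x) := by
  have hm1 : Measurable fun s : ℝ => x - s := by fun_prop
  have hm2 := hS.measurable.const_sub (ψ x)
  have i0 := integrableOn_szegoTest_mul_conj hS.measurable hS.volume_ne_top h0 h1 (x, ψ x)
  have i1 := integrableOn_norm_szegoKernel hS.volume_ne_top h0 h1 hm1
  have i2 := integrableOn_norm_szegoKernel hS.volume_ne_top h0 h1 hm2
  have hpos : ∀ s ∈ S, d ^ 4 / ((d + |x - s|) ^ 2 * (d + |ψ x - ψ s|) ^ 2) ≤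
      (szegoKernel d (x - s) * conj (szegoKernel d (ψ x - ψ s))).re := fun s hs => by
    have b1 := hS.subset hs
    have b2 := hS.mapsTo s hs
    have b3 := hS.subset hx
    have b4 := hS.mapsTo x hx
    refine le_re_szegoKernel_mul_conj h0 h1 ?_ ?_ ?_
    · rcases le_total s x with h | h
      · exact mul_nonneg (by linarith) (by linarith [hS.strictMono.monotone h])
      · exact mul_nonneg_of_nonpos_of_nonpos (by linarith)
          (by linarith [hS.strictMono.monotone h])
    · rw [abs_le]; constructor <;> linarith [b1.1, b1.2, b3.1, b3.2]
    · rw [abs_le]; constructor <;> linarith [b2.1, b2.2, b4.1, b4.2]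
  -- On the circle the test function is the Szegő kernel minus `d`. Expanding the product gives
  -- linear terms of size `d`, absorbed by the error, and a term `d²` of favourable sign.
  have hpt : ∀ s, (szegoKernel d (x - s) * conj (szegoKernel d (ψ x - ψ s))).re ≤
      (szegoTest d (unitExp (x - s)) * conj (szegoTest d (unitExp (ψ x - ψ s)))).re +
        d * (‖szegoKernel d (x - s)‖ + ‖szegoKernel d (ψ x - ψ s)‖) := fun s => by
    rw [szegoTest_unitExp h0 h1, szegoTest_unitExp h0 h1]
    have r1 := Complex.re_le_norm (szegoKernel d (x - s))
    have r2 := Complex.re_le_norm (szegoKernel d (ψ x - ψ s))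
    simp only [map_sub, Complex.conj_ofReal, Complex.mul_re, Complex.sub_re, Complex.sub_im,
      Complex.conj_re, Complex.conj_im, Complex.ofReal_re, Complex.ofReal_im]
    nlinarith [mul_le_mul_of_nonneg_left r1 h0.le, mul_le_mul_of_nonneg_left r2 h0.le,
      sq_nonneg d]
  -- Within distance `d` of `x` the denominator is at most `(2d)² ((1+L) d)² = 4 (1+L)² d⁴`.
  have hconst : ∀ s ∈ S ∩ T, (4 * (1 + L) ^ 2)⁻¹ ≤
      d ^ 4 / ((d + |x - s|) ^ 2 * (d + |ψ x - ψ s|) ^ 2) := fun s hs => by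
    have b1 : |x - s| ≤ d := by simpa [Real.dist_eq, abs_sub_comm] using hT hs.2
    have b2 : |ψ x - ψ s| ≤ L * d := (hLip s hs.2).trans (mul_le_mul_of_nonneg_left b1 hL)
    rw [le_div_iff₀ (by positivity), inv_mul_le_iff₀ (by positivity)]
    calc (d + |x - s|) ^ 2 * (d + |ψ x - ψ s|) ^ 2 ≤ (d + d) ^ 2 * (d + L * d) ^ 2 := by gcongr
      _ = _ := by ring
  have hmain : volume.real (S ∩ T) * (4 * (1 + L) ^ 2)⁻¹ ≤
      ∫ s in S, ((szegoTest d (unitExp (x - s)) * conj (szegoTest d (unitExp (ψ x - ψ s)))).re +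
        d * (‖szegoKernel d (x - s)‖ + ‖szegoKernel d (ψ x - ψ s)‖)) := by
    have hSm := hS.isCompact.measurableSet
    have hint : IntegrableOn (fun s => (szegoTest d (unitExp (x - s)) *
        conj (szegoTest d (unitExp (ψ x - ψ s)))).re +
        d * (‖szegoKernel d (x - s)‖ + ‖szegoKernel d (ψ x - ψ s)‖)) S :=
      i0.re.add ((i1.add i2).const_mul d)
    calc _ = ∫ s in S ∩ T, (4 * (1 + L) ^ 2)⁻¹ := by
          rw [setIntegral_const, smul_eq_mul]
      _ ≤ ∫ s in S ∩ T, ((szegoTest d (unitExp (x - s)) *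
            conj (szegoTest d (unitExp (ψ x - ψ s)))).re +
            d * (‖szegoKernel d (x - s)‖ + ‖szegoKernel d (ψ x - ψ s)‖)) := by
          refine setIntegral_mono_on (integrableOn_const
            (measure_mono_top inter_subset_left |>.mt hS.volume_ne_top))
            (hint.mono_set inter_subset_left) (hSm.inter hTm) fun s hs => ?_
          exact (hconst s hs).trans ((hpos s hs.1).trans (hpt s))
      _ ≤ _ := by
          refine setIntegral_mono_set hint ?_ (LE.le.eventuallyLE inter_subset_left)
          filter_upwards [ae_restrict_mem hSm] with s hs
          exact le_trans (by positivity) ((hpos s hs).trans (hpt s))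
  have hre : (curveKernel ψ S d (x, ψ x)).re = d⁻¹ * ∫ s in S,
      (szegoTest d (unitExp (x - s)) * conj (szegoTest d (unitExp (ψ x - ψ s)))).re := by
    rw [curveKernel, ← Complex.ofReal_inv, Complex.re_ofReal_mul]
    congr 1
    exact (integral_re i0).symm
  rw [hre, curveError, inv_mul_le_iff₀ h0, mul_add, mul_inv_cancel_left₀ h0.ne']
  refine hmain.trans_eq ?_
  rw [← integral_const_mul]
  exact integral_add i0.re ((i1.add i2).const_mul d)

end IsSteepOn

end Curve

/-! ### Negligibility of steep graphs. -/

lemma MeasureTheory.Measure.MutuallySingular.map_of_leftInverse {X Y : Type*} [MeasurableSpace X]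
    [MeasurableSpace Y] {P N : Measure X} (h : P ⟂ₘ N) {f : X → Y} {g : Y → X}
    (hf : Measurable f) (hg : Measurable g) (hgf : Function.LeftInverse g f) :
    P.map f ⟂ₘ N.map f := by
  obtain ⟨s, hs, hP, hN⟩ := h
  have e : f ⁻¹' (g ⁻¹' s) = s := by
    ext x
    simp [hgf x]
  refine ⟨g ⁻¹' s, hg hs, ?_, ?_⟩
  · rw [Measure.map_apply hf (hg hs), e, hP]
  · rw [Measure.map_apply hf (hg hs).compl, preimage_compl, e, hN]

lemma measurableSet_graphOn {ψ : ℝ → ℝ} (hψ : Measurable ψ) {B : Set ℝ} (hB : MeasurableSet B) :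
    MeasurableSet {p : ℝ × ℝ | p.1 ∈ B ∧ p.2 = ψ p.1} :=
  (measurable_fst hB).inter (measurableSet_eq_fun measurable_snd (hψ.comp measurable_fst))

namespace IsSteepOn

variable {ψ : ℝ → ℝ} {S : Set ℝ} {n : ℝ}

/-- Differentiability at `x` supplies the constant `L`. Density one makes `S` fill more than half of
the interval of length `2d`, hence at least length `d`, which cancels `1/d`. -/
lemma eventually_le_re_curveKernel_add_curveError (hS : IsSteepOn ψ S n) {δ : ℕ → ℝ}
    (h0 : ∀ m, 0 < δ m) (h1 : ∀ m, δ m < 1) (hδ : Tendsto δ atTop (𝓝 0)) {x : ℝ} (hx : x ∈ S)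
    (hdens : Tendsto (fun r => volume (S ∩ closedBall x r) / volume (closedBall x r)) (𝓝[>] 0)
      (𝓝 1)) :
    ∃ c > 0, ∀ᶠ m in atTop,
      c ≤ (curveKernel ψ S (δ m) (x, ψ x)).re + curveError ψ S (δ m) (x, ψ x) := by
  obtain ⟨L, hL, hb⟩ := (hS.differentiableAt x hx).hasDerivAt.isBigO_sub.exists_pos
  rw [Asymptotics.isBigOWith_iff, Metric.eventually_nhds_iff_ball] at hb
  obtain ⟨ε, hε, hb⟩ := hb
  have hδ' : Tendsto δ atTop (𝓝[>] 0) :=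
    tendsto_nhdsWithin_iff.2 ⟨hδ, .of_forall h0⟩
  refine ⟨(4 * (1 + L) ^ 2)⁻¹, by positivity, ?_⟩
  filter_upwards [hδ.eventually (gt_mem_nhds hε), (hdens.comp hδ').eventually
    (lt_mem_nhds (by simp : (2⁻¹ : ENNReal) < 1))] with m hm hd
  have hdm := h0 m
  refine le_trans ?_ (hS.re_curveKernel_add_curveError_ge hdm (h1 m) hx hL.le
    measurableSet_closedBall le_rfl fun s hs => ?_)
  · have hvol : δ m ≤ volume.real (S ∩ closedBall x (δ m)) := by
      have hne : volume (S ∩ closedBall x (δ m)) ≠ ⊤ :=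
        measure_mono_top inter_subset_left |>.mt hS.volume_ne_top
      rw [Function.comp_apply, Real.volume_closedBall,
        ENNReal.lt_div_iff_mul_lt (Or.inl (by simpa using hdm)) (Or.inl ENNReal.ofReal_ne_top)] at hd
      rw [Measure.real, ← ENNReal.ofReal_le_iff_le_toReal hne]
      refine le_trans (le_of_eq ?_) hd.le
      rw [ENNReal.ofReal_mul zero_le_two, ENNReal.ofReal_ofNat, ← mul_assoc,
        ENNReal.inv_mul_cancel two_ne_zero ENNReal.ofNat_ne_top, one_mul]
    rw [← mul_assoc]
    refine le_mul_of_one_le_left (by positivity) ?_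
    rw [inv_mul_eq_div, one_le_div hdm]
    exact hvol
  · have := hb s (closedBall_subset_ball hm hs)
    rwa [Real.norm_eq_abs, Real.norm_eq_abs, abs_sub_comm, abs_sub_comm s] at this

/-- The graph of an increasing function over a compact set where its derivative is bounded below is
negligible for the left member of a mutually singular pair, provided it is for the right one. -/
lemma measure_graph_eq_zero (hS : IsSteepOn ψ S n) (hn : 0 ≤ n) {P N : Measure (ℝ × ℝ)}
    [IsFiniteMeasure P] [IsFiniteMeasure N] (hPN : IsRPPair P N) (hs : P ⟂ₘ N)
    (hN : N {p | p.1 ∈ S ∧ p.2 = ψ p.1} = 0) : P {p | p.1 ∈ S ∧ p.2 = ψ p.1} = 0 := by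
  set G : Set (ℝ × ℝ) := {p | p.1 ∈ S ∧ p.2 = ψ p.1} with hG
  have hGm : MeasurableSet G := measurableSet_graphOn hS.measurable hS.isCompact.measurableSet
  -- The widths are `1/(m+2)`, so that the first one is already less than `1`.
  set δ : ℕ → ℝ := fun m => 1 / ((m : ℝ) + 1 + 1) with hδdef
  have h0 : ∀ m, 0 < δ m := fun m => by simp only [hδdef]; positivity
  have h1 : ∀ m, δ m < 1 := fun m => by
    simp only [hδdef]
    rw [div_lt_one (by positivity)]
    have : (0 : ℝ) ≤ m := m.cast_nonneg
    linarith
  have hδ : Tendsto δ atTop (𝓝 0) := by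
    have := (tendsto_add_atTop_iff_nat 1).2 (tendsto_one_div_add_atTop_nhds_zero_nat (𝕜 := ℝ))
    simpa [hδdef] using this
  have hmK := fun m => measurable_curveKernel (S := S) hS.measurable (h0 m) (h1 m)
  have hmE := fun m => measurable_curveError (S := S) hS.measurable (h0 m) (h1 m)
  have hiK : ∀ m, ∀ Q : Measure (ℝ × ℝ), IsFiniteMeasure Q →
      Integrable (curveKernel ψ S (δ m)) Q := fun m Q _ =>
    Integrable.of_bound (hmK m).aestronglyMeasurable _
      (.of_forall (hS.norm_curveKernel_le hn (h0 m) (h1 m)))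
  have hiE : ∀ m, Integrable (curveError ψ S (δ m)) P := fun m =>
    Integrable.of_bound (hmE m).aestronglyMeasurable 2
      (.of_forall (hS.abs_curveError_le (h0 m) (h1 m)))
  have hoff : ∀ Q : Measure (ℝ × ℝ), IsFiniteMeasure Q →
      (∀ᵐ p ∂Q, p.1 ∈ Ioc (-Real.pi) Real.pi ∧ p.2 ∈ Ioc (-Real.pi) Real.pi) →
      Tendsto (fun m => ∫ p in Gᶜ, curveKernel ψ S (δ m) p ∂Q) atTop (𝓝 0) := by
    intro Q _ hQ
    have := tendsto_integral_of_dominated_convergence (μ := Q.restrict Gᶜ)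
      (F := fun m => curveKernel ψ S (δ m)) (f := fun _ => 0) (fun _ => 2 * Real.pi * (1 + n))
      (fun m => (hmK m).aestronglyMeasurable) (integrable_const _)
      (fun m => .of_forall (hS.norm_curveKernel_le hn (h0 m) (h1 m))) (by
        filter_upwards [ae_restrict_mem hGm.compl, ae_restrict_of_ae hQ] with p hp hp'
        exact hS.tendsto_curveKernel h0 h1 hδ hp' hp)
    simpa using this
  -- The kernel has equal integrals against `P` and `N`. Both integrals off the graph tend to `0`,
  -- and `N` does not charge the graph.
  have hon : Tendsto (fun m => ∫ p in G, curveKernel ψ S (δ m) p ∂P) atTop (𝓝 0) := by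
    have := (hoff N inferInstance hPN.mem_right).sub (hoff P inferInstance hPN.mem_left)
    rw [sub_zero] at this
    refine this.congr fun m => ?_
    have e := hPN.integral_curveKernel_eq (S := S) hS.measurable hS.volume_ne_top (h0 m) (h1 m)
    rw [← integral_add_compl hGm (hiK m P inferInstance),
      ← integral_add_compl hGm (hiK m N inferInstance), setIntegral_measure_zero _ hN,
      zero_add] at e
    rw [← e]
    ring
  have hErr : Tendsto (fun m => ∫ p in G, curveError ψ S (δ m) p ∂P) atTop (𝓝 0) := by
    have := tendsto_integral_of_dominated_convergence (μ := P.restrict G)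
      (F := fun m => curveError ψ S (δ m)) (f := fun _ => 0) (fun _ => 2)
      (fun m => (hmE m).aestronglyMeasurable) (integrable_const _)
      (fun m => .of_forall (hS.abs_curveError_le (h0 m) (h1 m))) (by
        filter_upwards [ae_restrict_of_ae hPN.mem_left] with p hp
        exact hS.tendsto_curveError h0 h1 hδ hp)
    simpa using this
  set U : ℕ → ℝ × ℝ → ℝ := fun m p => (curveKernel ψ S (δ m) p).re + curveError ψ S (δ m) p with hU
  have hUm : ∀ m, Measurable (U m) := fun m =>
    (Complex.measurable_re.comp (hmK m)).add (hmE m)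
  have hU0 : ∀ m, ∀ p ∈ G, 0 ≤ U m p := by
    rintro m ⟨x, y⟩ ⟨hx, hy⟩
    change y = ψ x at hy
    subst hy
    have := hS.re_curveKernel_add_curveError_ge (h0 m) (h1 m) hx le_rfl (T := ∅)
      MeasurableSet.empty (empty_subset _) (by simp)
    simpa using this
  have hUlim : Tendsto (fun m => ∫ p in G, U m p ∂P) atTop (𝓝 0) := by
    have := ((Complex.continuous_re.tendsto _).comp hon).add hErr
    simp only [Complex.zero_re, add_zero] at this
    refine this.congr fun m => ?_
    have e1 : (∫ p in G, curveKernel ψ S (δ m) p ∂P).re =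
        ∫ p in G, (curveKernel ψ S (δ m) p).re ∂P :=
      (integral_re (hiK m P inferInstance).integrableOn).symm
    rw [Function.comp_apply, e1]
    exact (integral_add (hiK m P inferInstance).integrableOn.re (hiE m).integrableOn).symm
  -- Fatou's lemma applies because `U` is nonnegative on the graph; the lower limit is then zero
  -- `P`-almost everywhere on it.
  have hfatou : ∫⁻ p in G, liminf (fun m => ENNReal.ofReal (U m p)) atTop ∂P = 0 := by
    refine le_antisymm ?_ zero_le
    refine (lintegral_liminf_le fun m => (hUm m).ennreal_ofReal).trans (le_of_eq ?_)
    have e : ∀ m, ∫⁻ p in G, ENNReal.ofReal (U m p) ∂P = ENNReal.ofReal (∫ p in G, U m p ∂P) :=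
      fun m => by
      rw [ofReal_integral_eq_lintegral_ofReal]
      · exact ((hiK m P inferInstance).re.add (hiE m)).integrableOn
      · filter_upwards [ae_restrict_mem hGm] with p hp using hU0 m p hp
    simp only [e]
    have := ENNReal.tendsto_ofReal hUlim
    rw [ENNReal.ofReal_zero] at this
    exact this.liminf_eq
  rw [lintegral_eq_zero_iff (Measurable.liminf fun m => (hUm m).ennreal_ofReal)] at hfatou
  have hdens := Besicovitch.ae_tendsto_measure_inter_div volume S
  -- `Z` is a measurable null set containing the points of `S` where the density is not one; the
  -- graph over it falls under the null-base case.
  set Z : Set ℝ := S ∩ toMeasurable (volume.restrict S) {x | ¬ Tendsto (fun r =>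
    volume (S ∩ closedBall x r) / volume (closedBall x r)) (𝓝[>] 0) (𝓝 1)} with hZ
  have hZm : MeasurableSet Z := hS.isCompact.measurableSet.inter (measurableSet_toMeasurable _ _)
  have hZ0 : volume Z = 0 := by
    rw [hZ, inter_comm, ← Measure.restrict_apply (measurableSet_toMeasurable _ _),
      measure_toMeasurable]
    exact hdens
  have hPZ := hPN.measure_graph_eq_zero hs hZm hZ0 (inter_subset_left.trans hS.subset)
    hS.measurable fun x hx => hS.mapsTo x hx.1
  have hae : ∀ᵐ p ∂P, p ∉ G := by
    have h3 := (ae_restrict_iff' hGm).1 hfatou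
    filter_upwards [h3, measure_eq_zero_iff_ae_notMem.1 hPZ] with p hp hpZ hpG
    obtain ⟨x, y⟩ := p
    obtain ⟨hx, hy⟩ := id hpG
    change y = ψ x at hy
    subst hy
    have hxd : Tendsto (fun r => volume (S ∩ closedBall x r) / volume (closedBall x r)) (𝓝[>] 0)
        (𝓝 1) := by
      by_contra hc
      exact hpZ ⟨⟨hx, subset_toMeasurable _ _ hc⟩, rfl⟩
    obtain ⟨c, hc, hev⟩ := hS.eventually_le_re_curveKernel_add_curveError h0 h1 hδ hx hxd
    have h4 : ENNReal.ofReal c ≤ liminf (fun m => ENNReal.ofReal (U m (x, ψ x))) atTop :=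
      le_liminf_of_le (by isBoundedDefault) (hev.mono fun m hm => ENNReal.ofReal_le_ofReal hm)
    have h5 : liminf (fun m => ENNReal.ofReal (U m (x, ψ x))) atTop = 0 := hp hpG
    rw [h5] at h4
    simp [hc.not_ge] at h4
  exact measure_eq_zero_iff_ae_notMem.2 hae

end IsSteepOn

/-! ### Splitting the graph according to the derivative. -/

namespace IsRPPair

variable {P N : Measure (ℝ × ℝ)} [IsFiniteMeasure P] [IsFiniteMeasure N] {ψ : ℝ → ℝ}

/-- A set where the derivative vanishes has a null image. Seen from the second axis, the graph is
that of the inverse function over this null image. -/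
lemma measure_graph_deriv_eq_zero (hPN : IsRPPair P N) (hs : P ⟂ₘ N) (hψ : StrictMono ψ)
    {B : Set ℝ} (hB : MeasurableSet B) (hsub : B ⊆ Ico 0 1) (hmaps : ∀ x ∈ B, ψ x ∈ Ico 0 1)
    (hd : ∀ x ∈ B, HasDerivAt ψ 0 x) : P {p | p.1 ∈ B ∧ p.2 = ψ p.1} = 0 := by
  have he : MeasurableEmbedding ψ := hψ.monotone.measurable.measurableEmbedding hψ.injective
  have himg : volume (ψ '' B) = 0 := by
    have := lintegral_image_eq_lintegral_abs_deriv_mul hB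
      (fun x hx => (hd x hx).hasDerivWithinAt) hψ.injective.injOn fun _ => 1
    simpa using this
  -- A measurable left inverse of `ψ`; its default value `0` off the range plays no role over `ψ ''
  -- B`.
  have hθ : Measurable (Function.extend ψ id fun _ => (0 : ℝ)) :=
    he.measurable_extend measurable_id measurable_const
  have hext : ∀ x, Function.extend ψ id (fun _ => (0 : ℝ)) (ψ x) = x := fun x =>
    hψ.injective.extend_apply _ _ _
  have : IsFiniteMeasure (P.map Prod.swap) := Measure.isFiniteMeasure_map _ _
  have : IsFiniteMeasure (N.map Prod.swap) := Measure.isFiniteMeasure_map _ _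
  have hz := hPN.swap.measure_graph_eq_zero
    (hs.map_of_leftInverse measurable_swap measurable_swap Prod.swap_leftInverse)
    (he.measurableSet_image.2 hB) himg (by rintro _ ⟨x, hx, rfl⟩; exact hmaps x hx) hθ
    (by rintro _ ⟨x, hx, rfl⟩; rw [hext]; exact hsub hx)
  rw [Measure.map_apply measurable_swap
    (measurableSet_graphOn hθ (he.measurableSet_image.2 hB))] at hz
  refine measure_mono_null ?_ hz
  rintro ⟨x, y⟩ ⟨hx, hy⟩
  change y = ψ x at hy
  subst hy
  exact ⟨⟨x, hx, rfl⟩, (hext x).symm⟩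

/-- The part of the graph in `s` is `P`-null. The rest lies in the `N`-null set `sᶜ`, and inner
regularity of the projected measure `Q` reduces it to compact bases, where the steep case applies.
-/
lemma measure_graph_one_le_deriv_eq_zero (hPN : IsRPPair P N) (hs : P ⟂ₘ N) (hψ : StrictMono ψ)
    {B : Set ℝ} (hB : MeasurableSet B) (hsub : B ⊆ Ico 0 1) (hmaps : ∀ x ∈ B, ψ x ∈ Ico 0 1)
    {n : ℝ} (hn : 0 ≤ n) (hd : ∀ x ∈ B, DifferentiableAt ℝ ψ x)
    (hle : ∀ x ∈ B, 1 ≤ n * deriv ψ x) : P {p | p.1 ∈ B ∧ p.2 = ψ p.1} = 0 := by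
  have hψm : Measurable ψ := hψ.monotone.measurable
  obtain ⟨s, hsm, hPs, hNs⟩ := id hs
  set B' : Set ℝ := B ∩ (fun x => (x, ψ x)) ⁻¹' sᶜ with hB'
  have hB'm : MeasurableSet B' := hB.inter ((measurable_id.prodMk hψm) hsm.compl)
  set Q : Measure ℝ := (P.restrict {p | p.2 = ψ p.1}).map Prod.fst with hQ
  have hQa : ∀ A : Set ℝ, MeasurableSet A → Q A = P {p | p.1 ∈ A ∧ p.2 = ψ p.1} := fun A hA => by
    rw [hQ, Measure.map_apply measurable_fst hA, Measure.restrict_apply (measurable_fst hA)]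
    rfl
  have hQB : Q B' = 0 := by
    by_contra hne
    obtain ⟨K, hKB, hK, hK0⟩ := hB'm.exists_lt_isCompact (pos_iff_ne_zero.2 hne)
    have hsteep : IsSteepOn ψ K n := ⟨hψ, hK, fun x hx => hsub (hKB hx).1,
      fun x hx => hmaps x (hKB hx).1, fun x hx => hd x (hKB hx).1, fun x hx => hle x (hKB hx).1⟩
    have := hsteep.measure_graph_eq_zero hn hPN hs (measure_mono_null (t := sᶜ) (by
      rintro ⟨x, y⟩ ⟨hx, hy⟩
      change y = ψ x at hy
      subst hy
      exact (hKB hx).2) hNs)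
    rw [hQa K hK.measurableSet, this] at hK0
    exact lt_irrefl _ hK0
  rw [hQa B' hB'm] at hQB
  refine measure_mono_null ?_ (measure_union_null hPs hQB)
  rintro ⟨x, y⟩ ⟨hx, hy⟩
  change y = ψ x at hy
  subst hy
  by_cases h : (x, ψ x) ∈ s
  · exact Or.inl h
  · exact Or.inr ⟨⟨hx, h⟩, rfl⟩

/-- The part in the unit square of the graph of a strictly increasing function is negligible for the
left member of a mutually singular pair. -/
theorem measure_graph_unitSquare_eq_zero (hPN : IsRPPair P N) (hs : P ⟂ₘ N)
    (hψ : StrictMono ψ) : P {p | p.1 ∈ Ico 0 1 ∧ ψ p.1 ∈ Ico 0 1 ∧ p.2 = ψ p.1} = 0 := by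
  have hψm : Measurable ψ := hψ.monotone.measurable
  have hDm : MeasurableSet {x | DifferentiableAt ℝ ψ x} := measurableSet_of_differentiableAt ℝ ψ
  set W : Set ℝ := Ico 0 1 ∩ ψ ⁻¹' Ico 0 1 with hW
  have hWm : MeasurableSet W := measurableSet_Ico.inter (hψm measurableSet_Ico)
  -- A monotone function is differentiable almost everywhere, so the exceptional base is null.
  have z0 := hPN.measure_graph_eq_zero hs (hWm.diff hDm) (measure_mono_null (fun x hx => hx.2)
    hψ.monotone.ae_differentiableAt) (fun x hx => hx.1.1) hψm fun x hx => hx.1.2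
  have z1 := hPN.measure_graph_deriv_eq_zero hs hψ (B := W ∩ {x | DifferentiableAt ℝ ψ x} ∩
    deriv ψ ⁻¹' {0}) ((hWm.inter hDm).inter (measurable_deriv ψ (measurableSet_singleton 0)))
    (fun x hx => hx.1.1.1) (fun x hx => hx.1.1.2) fun x hx => by
      have h1 : DifferentiableAt ℝ ψ x := hx.1.2
      have h2 : deriv ψ x = 0 := hx.2
      exact h2 ▸ h1.hasDerivAt
  have z2 : ∀ n : ℕ, _ := fun n => hPN.measure_graph_one_le_deriv_eq_zero hs hψ
    (B := W ∩ {x | DifferentiableAt ℝ ψ x} ∩ {x | 1 ≤ n * deriv ψ x})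
    ((hWm.inter hDm).inter (measurableSet_le measurable_const ((measurable_deriv ψ).const_mul _)))
    (fun x hx => hx.1.1.1) (fun x hx => hx.1.1.2) (n := n) n.cast_nonneg (fun x hx => hx.1.2)
    fun x hx => hx.2
  refine measure_mono_null ?_ (measure_union_null z0 (measure_union_null z1
    (measure_iUnion_null z2)))
  rintro ⟨x, y⟩ ⟨hx, hy, hxy⟩
  by_cases hd : DifferentiableAt ℝ ψ x
  · right
    rcases eq_or_ne (deriv ψ x) 0 with h | h
    · exact Or.inl ⟨⟨⟨⟨hx, hy⟩, hd⟩, h⟩, hxy⟩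
    · right
      have hpos : 0 < deriv ψ x := lt_of_le_of_ne hψ.monotone.deriv_nonneg h.symm
      obtain ⟨n, hn⟩ := exists_nat_ge (deriv ψ x)⁻¹
      refine mem_iUnion.2 ⟨n, ⟨⟨⟨⟨hx, hy⟩, hd⟩, ?_⟩, hxy⟩⟩
      change 1 ≤ n * deriv ψ x
      rwa [inv_le_iff_one_le_mul₀ hpos] at hn
  · exact Or.inl ⟨⟨⟨hx, hy⟩, hd⟩, hxy⟩

end IsRPPair

/-! ### Return to the torus. -/

/-- Angular coordinates on the two-dimensional torus, based at the point `(e^{ia}, e^{ib})`. -/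
noncomputable def torusAngle (a b : ℝ) (ζ : Torus 2) : ℝ × ℝ :=
  (Complex.arg (ζ 0 * unitExp (-a)), Complex.arg (ζ 1 * unitExp (-b)))

/-- The point of the torus with given angular coordinates based at `(e^{ia}, e^{ib})`. -/
noncomputable def torusOfAngle (a b : ℝ) (p : ℝ × ℝ) : Torus 2 :=
  ![Circle.exp (p.1 + a), Circle.exp (p.2 + b)]

lemma measurable_torusAngle (a b : ℝ) : Measurable (torusAngle a b) := by
  have h : ∀ (j : Fin 2) (c : ℝ), Measurable fun ζ : Torus 2 => (ζ j : ℂ) * unitExp (-c) :=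
    fun j c => (Continuous.measurable (by fun_prop))
  exact (Complex.measurable_arg.comp (h 0 a)).prodMk (Complex.measurable_arg.comp (h 1 b))

lemma measurable_torusOfAngle (a b : ℝ) : Measurable (torusOfAngle a b) := by
  refine measurable_pi_iff.2 fun j => ?_
  have h : ∀ c : ℝ, Measurable fun t : ℝ => Circle.exp (t + c) := fun c =>
    Continuous.measurable (by fun_prop)
  fin_cases j
  · exact (h a).comp measurable_fst
  · exact (h b).comp measurable_snd

lemma unitExp_arg {z : ℂ} (hz : ‖z‖ = 1) : unitExp (Complex.arg z) = z := by
  have := Complex.norm_mul_exp_arg_mul_I z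
  rwa [hz, Complex.ofReal_one, one_mul] at this

lemma arg_unitExp {t : ℝ} (ht : t ∈ Ioc (-Real.pi) Real.pi) : Complex.arg (unitExp t) = t := by
  rw [unitExp, Complex.exp_mul_I]
  exact Complex.arg_cos_add_sin_mul_I ht

lemma norm_circle_mul_unitExp (w : Circle) (a : ℝ) : ‖(w : ℂ) * unitExp a‖ = 1 := by
  rw [norm_mul, norm_unitExp, Circle.norm_coe, one_mul]

lemma circleExp_arg_add (w : Circle) (a : ℝ) :
    Circle.exp (Complex.arg (w * unitExp (-a)) + a) = w := by
  apply Circle.ext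
  rw [Circle.coe_exp]
  change unitExp _ = _
  rw [unitExp_add, unitExp_arg (norm_circle_mul_unitExp _ _), mul_assoc, ← unitExp_add]
  simp [unitExp]

lemma leftInverse_torusOfAngle (a b : ℝ) :
    Function.LeftInverse (torusOfAngle a b) (torusAngle a b) := by
  intro ζ
  funext j
  fin_cases j
  · exact circleExp_arg_add _ _
  · exact circleExp_arg_add _ _

/-- Moving the base point of the angles rotates the test functions, which stay in the same class. -/
lemma isRPPair_map_torusAngle {P N : Measure (Torus 2)}
    (h : ∀ g k : ℂ → ℂ, IsDiscTest g → IsDiscTest k →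
      ∫ ζ, g (ζ 0) * conj (k (ζ 1)) ∂P = ∫ ζ, g (ζ 0) * conj (k (ζ 1)) ∂N) (a b : ℝ) :
    IsRPPair (P.map (torusAngle a b)) (N.map (torusAngle a b)) := by
  have hm := measurable_torusAngle a b
  have hmem : ∀ Q : Measure (Torus 2), ∀ᵐ p ∂(Q.map (torusAngle a b)),
      p.1 ∈ Ioc (-Real.pi) Real.pi ∧ p.2 ∈ Ioc (-Real.pi) Real.pi := fun Q => by
    have hs : MeasurableSet {p : ℝ × ℝ | p.1 ∈ Ioc (-Real.pi) Real.pi ∧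
        p.2 ∈ Ioc (-Real.pi) Real.pi} :=
      (measurable_fst measurableSet_Ioc).inter (measurable_snd measurableSet_Ioc)
    exact (ae_map_iff hm.aemeasurable hs).2
      (.of_forall fun ζ => ⟨Complex.arg_mem_Ioc _, Complex.arg_mem_Ioc _⟩)
  refine ⟨hmem P, hmem N, fun g k hg hk => ?_⟩
  have hc : Continuous fun p : ℝ × ℝ => g (unitExp p.1) * conj (k (unitExp p.2)) :=
    (hg.continuous_unitExp.comp continuous_fst).mul
      (Complex.continuous_conj.comp (hk.continuous_unitExp.comp continuous_snd))
  have := h _ _ (hg.mul_const_left (norm_unitExp (-a))) (hk.mul_const_left (norm_unitExp (-b)))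
  rw [integral_map hm.aemeasurable hc.aestronglyMeasurable,
    integral_map hm.aemeasurable hc.aestronglyMeasurable]
  simpa only [torusAngle, unitExp_arg (norm_circle_mul_unitExp _ _)] using this

lemma torusAngle_torusCover {x : Fin 2 → ℝ} {a b : ℝ} (h0 : x 0 - a ∈ Ico 0 1)
    (h1 : x 1 - b ∈ Ico 0 1) : torusAngle a b (torusCover x) = (x 0 - a, x 1 - b) := by
  have hpi := Real.pi_gt_three
  have key : ∀ s c : ℝ, s - c ∈ Ico (0 : ℝ) 1 →
      Complex.arg ((Circle.exp s : ℂ) * unitExp (-c)) = s - c := fun s c hs => by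
    rw [Circle.coe_exp]
    change Complex.arg (unitExp s * unitExp (-c)) = _
    rw [← unitExp_sub]
    exact arg_unitExp ⟨by linarith [hs.1], by linarith [hs.2]⟩
  exact Prod.ext (key _ _ h0) (key _ _ h1)

/-- The image in the torus of the graph of a strictly increasing function is negligible for the left
member of a pair of mutually singular measures whose difference annihilates the functions analytic
in the first variable and antianalytic in the second one. -/
theorem measure_torusCover_planeGraph_eq_zero {P N : Measure (Torus 2)} [IsFiniteMeasure P]
    [IsFiniteMeasure N] (h : ∀ g k : ℂ → ℂ, IsDiscTest g → IsDiscTest k →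
      ∫ ζ, g (ζ 0) * conj (k (ζ 1)) ∂P = ∫ ζ, g (ζ 0) * conj (k (ζ 1)) ∂N) (hs : P ⟂ₘ N)
    {ψ : ℝ → ℝ} (hψ : StrictMono ψ) : P (torusCover '' planeGraph ψ) = 0 := by
  -- Each square with integer corner `q` is read in the chart based there; its angles lie in `[0,
  -- 1)`, away from the jump of the argument.
  have hz : ∀ q : ℤ × ℤ, P (torusAngle q.1 q.2 ⁻¹' {p | p.1 ∈ Ico 0 1 ∧
      ψ (p.1 + q.1) - q.2 ∈ Ico 0 1 ∧ p.2 = ψ (p.1 + q.1) - q.2}) = 0 := fun q => by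
    have hm := measurable_torusAngle q.1 q.2
    have : IsFiniteMeasure (P.map (torusAngle q.1 q.2)) := Measure.isFiniteMeasure_map _ _
    have : IsFiniteMeasure (N.map (torusAngle q.1 q.2)) := Measure.isFiniteMeasure_map _ _
    have hψ' : StrictMono fun x => ψ (x + q.1) - q.2 := fun x y hxy =>
      sub_lt_sub_right (hψ (by linarith)) _
    have := (isRPPair_map_torusAngle h q.1 q.2).measure_graph_unitSquare_eq_zero
      (hs.map_of_leftInverse hm (measurable_torusOfAngle q.1 q.2)
        (leftInverse_torusOfAngle q.1 q.2)) hψ'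
    -- The inequality for push-forwards holds for every set, so measurability of this one need not
    -- be checked.
    exact le_antisymm ((Measure.le_map_apply hm.aemeasurable _).trans this.le) zero_le
  refine measure_mono_null ?_ (measure_iUnion_null hz)
  rintro _ ⟨x, hx, rfl⟩
  have hx' : x 1 = ψ (x 0) := hx
  have i0 : x 0 - ⌊x 0⌋ ∈ Ico (0 : ℝ) 1 := ⟨Int.fract_nonneg _, Int.fract_lt_one _⟩
  have i1 : x 1 - ⌊x 1⌋ ∈ Ico (0 : ℝ) 1 := ⟨Int.fract_nonneg _, Int.fract_lt_one _⟩
  refine mem_iUnion.2 ⟨(⌊x 0⌋, ⌊x 1⌋), ?_⟩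
  rw [mem_preimage, torusAngle_torusCover i0 i1]
  refine ⟨i0, ?_, ?_⟩
  · simpa [← hx'] using i1
  · simp [← hx']

/-- The relation between the Jordan parts is symmetric, so the result for the left member applies to
each of them. -/
lemma IsRPMeasure.totalVariation_torusCover_planeGraph {μ : SignedMeasure (Torus 2)}
    (hμ : IsRPMeasure μ) {ψ : ℝ → ℝ} (hψ : StrictMono ψ) :
    μ.totalVariation (torusCover '' planeGraph ψ) = 0 := by
  have hs := μ.toJordanDecomposition.mutuallySingular
  rw [SignedMeasure.totalVariation, Measure.add_apply,
    measure_torusCover_planeGraph_eq_zero (fun _ _ hg hh => hμ.integral_mul_conj_eq hg hh) hs hψ,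
    measure_torusCover_planeGraph_eq_zero (fun _ _ hg hh => (hμ.integral_mul_conj_eq hg hh).symm)
      hs.symm hψ, add_zero]

theorem mainTheorem2 (ψ : ℝ → ℝ) (hψ : StrictMono ψ) :
    (∀ K : Set (Torus 2), IsCompact K → K ⊆ torusCover '' planeGraph ψ → IsNullForRP K) ∧
    (∀ μ : SignedMeasure (Torus 2), IsRPMeasure μ →
      μ.totalVariation.support ⊆ torusCover '' planeGraph ψ → μ = 0) := by
  refine ⟨fun K _ hK μ hμ => measure_mono_null hK (hμ.totalVariation_torusCover_planeGraph hψ),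
    fun μ hμ hsupp => ?_⟩
  have h0 : μ.totalVariation univ = 0 := by
    rw [← union_compl_self μ.totalVariation.support]
    exact measure_union_null
      (measure_mono_null hsupp (hμ.totalVariation_torusCover_planeGraph hψ))
      Measure.measure_compl_support
  ext s _
  exact SignedMeasure.null_of_totalVariation_zero μ (measure_mono_null (subset_univ s) h0)
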